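/- **Conventions.** Let $\widetilde S_\infty$ be the group generated by $z,t_1,t_2,\dots$ with relations: $z$ is central, $z^2=1$, $t_i^2=z$, $t_it_{i+1}t_i=t_{i+1}t_it_{i+1}$, $t_jt_i=z\,t_it_j$ for $|i-j|>1$; let $\widetilde S_n$ be its subgroup generated by $z,t_1,\dots,t_{n-1}$ (the double cover of $S_n$), and let $\theta:\widetilde S_n\to S_n$, $t_i\mapsto(i,i+1)$, $z\mapsto1$. For $1\le i\le n$ put $x_i=t_it_{i+1}\cdots t_{n-1}t_nt_{n-1}\cdots t_{i+1}t_i\in\widetilde S_{n+1}$, and for distinct $i_1,\dots,i_m\in\{1,\dots,n\}$ put $[i_1]=z$ and $[i_1,\dots,i_m]=x_{i_1}x_{i_m}x_{i_{m-1}}\cdots x_{i_2}x_{i_1}$ for $m>1$; this is an element of $\widetilde S_n$ over the cycle $(i_1,\dots,i_m)$. For a commutative ring $R$ let $RS_n^-=R\widetilde S_n/\langle z+1\rangle$, and write $g$ also for the image of $g\in\widetilde S_n$. The coefficient of $g$ in $a\in RS_n^-$ is taken with respect to a basis consisting of one element (with $g$ among them) over each permutation. The degree of $g\in\widetilde S_n$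 is $\sum_i(\rho_i-1)$, where $\rho$ is the cycle type of $\theta(g)$. Let $\mathcal{EP}(m)$ be the set of partitions of $m$ with only even parts. For $\lambda=(\lambda_1\ge\dots\ge\lambda_\ell)\in\mathcal{EP}(m)$, $\ell=\ell(\lambda)$, and $n\ge m+\ell$, let $t_\lambda=[1,\dots,\lambda_1+1][\lambda_1+2,\dots,\lambda_1+\lambda_2+2]\cdots\in\widetilde S_n$ be the product of consecutive cycles of lengths $\lambda_1+1,\dots,\lambda_\ell+1$, and let $d_\lambda(n)\in RS_n^-$ be the image of the sum of the conjugacy class of $t_\lambda$ in $\widetilde S_n$; put $d_\lambda(n)=0$ if $n<m+\ell$. Let $M_k=\sum_{i=1}^{k-1}[i,k]$ for $1\le k\le n$ (the odd Jucys–Murphy elements) and $$e_{r;n}=\sum_{1\le i_1<\dots<i_r\le n}M_{i_1}^2\cdots M_{i_r}^2\in RS_n^-.$$ Finally $C_{k+1}=\frac1{k+1}\binom{2k}{k}$ for $k\ge0$ (so $C_1=1$, $C_2=1$, $C_3=2$, $C_4=5$). **Theorem.** For $\lambda\in\mathcal{EP}(2r)$, $r\ge 0$, let $A_\lambda\in\mathbb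 Z$ be the coefficient of $t_\lambda$ in $e_{r;n}\in\mathbb ZS_n^-$ for $n=|\lambda|+\ell(\lambda)$, and write $A_{2r}=A_{(2r)}$ for $r\ge1$. Then, for every commutative ring $R$ and all $r,n\ge 0$: 1. for each $\lambda\in\mathcal{EP}(2r)$ with $n\ge|\lambda|+\ell(\lambda)$, the coefficient of $t_\lambda$ in $e_{r;n}\in RS_n^-$ is (the image in $R$ of) $A_\lambda$; thus $A_\lambda$ does not depend on $n$; 2. the part of degree $2r$ of $e_{r;n}$ is $\sum_{\lambda\in\mathcal{EP}(2r)}A_\lambda d_\lambda(n)$: this sum is a linear combination of elements of $\widetilde S_n$ of degree $2r$, and its difference from $e_{r;n}$ is a linear combination of elements of $\widetilde S_n$ of degree less than $2r$. Over $R=\mathbb Z$ and for $n>2r$ it is the top-degree part: $e_{r;n}$ is not a linear combination of elements of degree less than $2r$. (So $e_r^*=\sum_{\lambda\in\mathcal{EP}(2r)}A_\lambda d_\lambda$ is the stable top-degree part of the $e_{r;n}$.) The coefficients are given by $$A_{2r}=-C_{r+1}\quad(r\ge1),\qquad A_\lambda=\prod_{i=1}^{\ell(\lambda)}A_{\lambda_i}=(-1)^{\ell(\lambda)}\prod_{i=1}^{\ell(\lambda)}C_{\lambda_i/2+1}\quad(\lambda\in\mathcal{EP}(2r),\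 r\ge0).$$ -/

import Mathlib

namespace SpinSym

/-! ### The double cover

The points permuted are numbered `0, 1, 2, …` (instead of `1, 2, 3, …`). -/

/-- Generators of the double cover: `t i` lifts the transposition `(i, i + 1)`; `z` is central. -/
inductive Gen : Type
  | t (i : ℕ)
  | z

/-- The defining relations: `z` central, `z² = 1`, `t_i² = z`, the braid relations,
and `t_j t_i = z t_i t_j` for `|i - j| > 1`. -/
inductive IsRel : FreeGroup Gen → Prop
  | z_central (i : ℕ) :
      IsRel (FreeGroup.of .z * FreeGroup.of (.t i) *
        (FreeGroup.of (.t i) * FreeGroup.of .z)⁻¹)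
  | z_sq : IsRel (FreeGroup.of .z ^ 2)
  | t_sq (i : ℕ) : IsRel (FreeGroup.of (.t i) ^ 2 * (FreeGroup.of .z)⁻¹)
  | braid (i : ℕ) :
      IsRel (FreeGroup.of (.t i) * FreeGroup.of (.t (i + 1)) * FreeGroup.of (.t i) *
        (FreeGroup.of (.t (i + 1)) * FreeGroup.of (.t i) * FreeGroup.of (.t (i + 1)))⁻¹)
  | far (i j : ℕ) (h : i + 1 < j ∨ j + 1 < i) :
      IsRel (FreeGroup.of (.t j) * FreeGroup.of (.t i) *
        (FreeGroup.of .z * FreeGroup.of (.t i) * FreeGroup.of (.t j))⁻¹)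

/-- The double cover of the infinite symmetric group, the union of the double covers of the
finite symmetric groups. -/
abbrev Cover : Type := PresentedGroup ({w | IsRel w})

/-- The generator `t_i` of the double cover. -/
def t (i : ℕ) : Cover := PresentedGroup.of (.t i)

/-- The central generator `z` of the double cover. -/
def z : Cover := PresentedGroup.of .z

/-- The double cover of the symmetric group on the points `0, …, n - 1`, as the subgroup of `Cover`
generated by `z` and by the `t_i` with `i + 1 < n`. -/
def coverN (n : ℕ) : Subgroup Cover := Subgroup.closure ({z} ∪ {g | ∃ i, i + 1 < n ∧ g = t i})

/-- The images of the generators in the symmetric group. -/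
def thetaGen : Gen → Equiv.Perm ℕ
  | .t i => Equiv.swap i (i + 1)
  | .z => 1

theorem thetaGen_rel (r : FreeGroup Gen) (hr : r ∈ {w | IsRel w}) :
    FreeGroup.lift thetaGen r = 1 := by
  cases hr with
  | z_central i => simp [thetaGen]
  | z_sq => simp [thetaGen]
  | t_sq i => simp [thetaGen, pow_two]
  | braid i =>
    simp only [map_mul, map_inv, FreeGroup.lift_apply_of, thetaGen, mul_inv_eq_one]
    ext x
    simp only [Equiv.Perm.mul_apply, Equiv.swap_apply_def]
    split_ifs <;> omega
  | far i j h =>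
    simp only [map_mul, map_inv, FreeGroup.lift_apply_of, thetaGen, mul_inv_eq_one, one_mul]
    ext x
    simp only [Equiv.Perm.mul_apply, Equiv.swap_apply_def]
    split_ifs <;> omega

/-- The projection `θ` of the double cover onto the (finitary) symmetric group. -/
def theta : Cover →* Equiv.Perm ℕ := PresentedGroup.toGroup thetaGen_rel

/-- `conjWord t d i = t i * ⋯ * t (i+d-1) * t (i+d) * t (i+d-1) * ⋯ * t i`. -/
def conjWord {G : Type*} [Mul G] (t : ℕ → G) : ℕ → ℕ → G
  | 0, i => t i
  | d + 1, i => t i * conjWord t d (i + 1) * t i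

/-- `x_i = t_i t_{i+1} ⋯ t_{n-1} ⋯ t_{i+1} t_i`, for a point `i < n`.  It lies in `coverN (n + 1)`
and lifts the transposition `(i, n)`. -/
def x (n i : ℕ) : Cover := conjWord t (n - 1 - i) i

/-- The cycle `[i₁, i₂, …, i_m] = x_{i₁} x_{i_m} ⋯ x_{i₂} x_{i₁}` (and `[i₁] = z`), for
distinct points `i₁, …, i_m < n`. It lifts the cycle `(i₁ i₂ … i_m)`. -/
def cycle (n : ℕ) : List ℕ → Cover
  | [] => 1
  | [_] => z
  | i :: l => x n i * (l.reverse.map (x n)).prod * x n i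

/-- `[s, …, s + a₁] [s + a₁ + 1, …, s + a₁ + a₂ + 1] ⋯`: consecutive cycles of lengths
`a₁ + 1, a₂ + 1, …`, starting at the point `s`. -/
def blocks (n : ℕ) : ℕ → List ℕ → Cover
  | _, [] => 1
  | s, a :: l => cycle n (List.range' s (a + 1)) * blocks n (s + a + 1) l

/-- The distinguished element `t_λ` of modified type `λ` in `coverN n`
(meaningful if `|λ| + ℓ(λ) ≤ n`). -/
def tElt (n : ℕ) {m : ℕ} (lam : Nat.Partition m) : Cover :=
  blocks n 0 (lam.parts.sort (· ≥ ·))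

/-- The conjugacy class `D_λ(n)` of `t_λ` in `coverN n`, empty unless `|λ| + ℓ(λ) ≤ n`. -/
def classD (n : ℕ) {m : ℕ} (lam : Nat.Partition m) : Set Cover :=
  {g | m + lam.parts.card ≤ n ∧ ∃ s ∈ coverN n, g = s * tElt n lam * s⁻¹}

/-- The modified cycle type of a permutation `σ` of the points `0, …, n - 1`: all parts of the cycle
type lowered by one. (Junk value `0` for a `σ` that does not preserve these points.) -/
noncomputable def modType (n : ℕ) (σ : Equiv.Perm ℕ) : Multiset ℕ :=
  open scoped Classical in
  if h : ∀ k, σ k < n ↔ k < n then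
    letI : Fintype {k // k < n} := Fintype.ofFinite _
    (σ.subtypePerm (p := fun k => k < n) h).cycleType.map (· - 1)
  else 0

/-- The degree of an element of `coverN n`: the size of its modified cycle type. -/
noncomputable def degree (n : ℕ) (g : Cover) : ℕ := (modType n (theta g)).sum

/-! ### The spin group algebra -/

theorem z_sq : z * z = 1 := by
  have h : PresentedGroup.mk ({w | IsRel w}) (FreeGroup.of .z ^ 2) = 1 :=
    PresentedGroup.one_of_mem IsRel.z_sq
  rw [pow_two, map_mul] at h
  exact h

theorem z_comm (g : Cover) : z * g = g * z := by
  have h : g ∈ Subgroup.centralizer ({z} : Set Cover) := by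
    refine PresentedGroup.generated_by _ _ (fun a => ?_) g
    rw [Subgroup.mem_centralizer_singleton_iff]
    cases a with
    | z => rfl
    | t i =>
      have h : PresentedGroup.mk ({w | IsRel w}) (FreeGroup.of .z * FreeGroup.of (.t i) *
          (FreeGroup.of (.t i) * FreeGroup.of .z)⁻¹) = 1 :=
        PresentedGroup.one_of_mem (IsRel.z_central i)
      rw [map_mul, map_inv, mul_inv_eq_one, map_mul, map_mul] at h
      exact h.symm
  exact (Subgroup.mem_centralizer_singleton_iff.mp h).symm

section Algebra

variable (R : Type*) [CommRing R]

theorem of_z_comm (a : MonoidAlgebra R Cover) :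
    a * (MonoidAlgebra.of R Cover z + 1) = (MonoidAlgebra.of R Cover z + 1) * a := by
  induction a using MonoidAlgebra.induction_on with
  | of g => rw [mul_add, add_mul, ← map_mul, ← map_mul, z_comm, mul_one, one_mul]
  | add a b ha hb => rw [add_mul, ha, hb, ← mul_add]
  | smul r a ha => rw [smul_mul_assoc, mul_smul_comm, ha]

/-- The (two-sided) ideal of the group algebra generated by the central element `z + 1`. -/
noncomputable def spinIdeal : Ideal (MonoidAlgebra R Cover) := Ideal.span {MonoidAlgebra.of R Cover z + 1}

instance spinIdeal_isTwoSided : (spinIdeal R).IsTwoSided where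
  mul_mem_of_left {a} b ha := by
    obtain ⟨c, rfl⟩ := Ideal.mem_span_singleton'.mp ha
    rw [mul_assoc, ← of_z_comm, ← mul_assoc]
    exact Ideal.mul_mem_left _ _ (Ideal.subset_span rfl)

/-- The spin group algebra `R[Cover] / ⟨z + 1⟩`. The spin group algebra of the symmetric group on
the points `0, …, n - 1` is the span in it of the images of the elements of `coverN n`. -/
abbrev SpinAlg : Type _ := MonoidAlgebra R Cover ⧸ spinIdeal R

/-- The image of a group element in the spin group algebra. -/
noncomputable def im (g : Cover) : SpinAlg R :=
  Ideal.Quotient.mk (spinIdeal R) (MonoidAlgebra.of R Cover g)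

/-- The coefficient of the group element `g` in an element of the spin group algebra (in which
`z g = -g`): it is induced by `a ↦ a_g - a_{z g}` on the group algebra. -/
noncomputable def coeff (g : Cover) : SpinAlg R →+ R :=
  QuotientAddGroup.lift (spinIdeal R).toAddSubgroup
    (AddMonoidHom.mk' (fun a : MonoidAlgebra R Cover => a.coeff g - a.coeff (z * g)) (by
      intro a b
      simp only [MonoidAlgebra.coeff_add, Finsupp.add_apply]
      ring))
    (by
      intro a ha
      obtain ⟨c, rfl⟩ := Ideal.mem_span_singleton'.mp ha
      have hz : z⁻¹ = z := inv_eq_of_mul_eq_one_left z_sq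
      simp only [AddMonoidHom.mem_ker, AddMonoidHom.mk'_apply, mul_add, mul_one,
        MonoidAlgebra.coeff_add, Finsupp.add_apply, MonoidAlgebra.of_apply,
        MonoidAlgebra.coeff_mul_single_apply, hz, mul_assoc, z_comm g, z_sq]
      ring)

/-- The class sum `d_λ(n)` in the spin group algebra (zero unless `|λ| + ℓ(λ) ≤ n`). -/
noncomputable def classSum (n : ℕ) {m : ℕ} (lam : Nat.Partition m) : SpinAlg R :=
  ∑ᶠ g ∈ classD n lam, im R g

/-- The odd Jucys-Murphy element attached to the point `k < n`: the sum of the `[i, k]`, `i < k`. -/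
noncomputable def jucysMurphy (n k : ℕ) : SpinAlg R :=
  ∑ i ∈ Finset.range k, im R (cycle n [i, k])

/-- The `r`-th elementary symmetric function `e_{r;n}` in the squares of the odd Jucys-Murphy
elements of the points `0, …, n - 1`; the factors of each product are in increasing order. -/
noncomputable def elemSymm (r n : ℕ) : SpinAlg R :=
  ∑ s ∈ (Finset.range n).powersetCard r,
    ((s.sort (· ≤ ·)).map fun k => jucysMurphy R n k ^ 2).prod

/-- The span of the images of the elements of degree `m` of `coverN n`. -/
noncomputable def homogeneous (n m : ℕ) : Submodule R (SpinAlg R) :=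
  Submodule.span R {a | ∃ g ∈ coverN n, degree n g = m ∧ a = im R g}

/-- The span of the images of the elements of degree less than `m` of `coverN n`. -/
noncomputable def lower (n m : ℕ) : Submodule R (SpinAlg R) :=
  Submodule.span R {a | ∃ g ∈ coverN n, degree n g < m ∧ a = im R g}

end Algebra

/-- `EP m`: the partitions of `m` all of whose parts are even. -/
def EP (m : ℕ) : Finset (Nat.Partition m) :=
  Finset.univ.filter fun lam => ∀ a ∈ lam.parts, Even a

/-- The coefficient `A_λ` of `d_λ` in `e_r^*`, for a partition `λ` of `2 r` into even parts: the
(stable) coefficient of `t_λ` in `e_{r;n}`, read off at the least possible `n = |λ| + ℓ(λ)`. -/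
noncomputable def A {m : ℕ} (lam : Nat.Partition m) : ℤ :=
  coeff ℤ (tElt (m + lam.parts.card) lam) (elemSymm ℤ (m / 2) (m + lam.parts.card))

end SpinSym

namespace SpinSym

/-! ### Relations in the double cover -/

/-! Everything rests on `e_{r+1;n+1} = e_{r+1;n} + e_{r;n} M²`, with `M` the Jucys–Murphy element of
the new point `n` (`elemSymm_succ_succ`). It turns the coefficient of a product `g` of disjoint
cycles into a recursion that deletes the point `n`. If `g` fixes `n`, the second term contributes
nothing in degree at least `2 (r + 1)`. Otherwise only the second term contributes, through the
elements `g * (tau b n * tau j n)⁻¹`, where `b` is the point sent to `n`. If `j` lies in another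
cycle, two cycles merge and the degree is too large for `e_{r;n}`. If `j` lies in the cycle of `n`,
that cycle loses `n` and is cut in two, and the degree drops by exactly two. So the coefficient in
degree `2 r` is a product over the cycles of weights obeying the Catalan recurrence
`weight_add_two`, and zero on even lengths. This is `coeff_elemSymm`.

The signs are governed by the conjugation rule `mul_tau`. The lift of a cycle of odd length is
insensitive to rotation (`star_rotate`), and conjugation relabels it without a sign (`mul_cyc`).
Lifts of cycles of even length are ambiguous, but there the weight is zero. Each of the `ℓ(λ)`
factors of `t_λ` differs from the lift `cyc` used here by one `z` (`cycle_range'`), whence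
`(-1)^ℓ(λ)`.

To pass from coefficients to the degree part, every element is up to sign a product of disjoint
cycles (`exists_prodCyc`), equal modified types mean conjugate up to sign (`exists_pm_conj`), and
vanishing coefficients in degree at least `m` force membership in `lower` (`mem_lower_of_coeff`).
Coefficients are meaningful because `z ≠ 1`, which is seen in a Clifford algebra. -/

theorem t_sq (i : ℕ) : t i * t i = z := by
  have h := PresentedGroup.one_of_mem (rels := {w | IsRel w}) (IsRel.t_sq i)
  rw [map_mul, map_inv, mul_inv_eq_one, pow_two, map_mul] at h
  exact h

theorem t_braid (i : ℕ) : t i * t (i + 1) * t i = t (i + 1) * t i * t (i + 1) := by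
  have h := PresentedGroup.one_of_mem (rels := {w | IsRel w}) (IsRel.braid i)
  rw [map_mul, map_inv, mul_inv_eq_one] at h
  simp only [map_mul] at h
  exact h

theorem t_far {i j : ℕ} (hij : i + 1 < j ∨ j + 1 < i) : t j * t i = z * (t i * t j) := by
  have h := PresentedGroup.one_of_mem (rels := {w | IsRel w}) (IsRel.far i j hij)
  rw [map_mul, map_inv, mul_inv_eq_one] at h
  simp only [map_mul, mul_assoc] at h
  exact h

theorem z_left (g h : Cover) : g * (z * h) = z * (g * h) := by
  rw [← mul_assoc, ← z_comm, mul_assoc]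

theorem z_z_mul (g : Cover) : z * (z * g) = g := by
  rw [← mul_assoc, z_sq, one_mul]

theorem z_inv : z⁻¹ = z := inv_eq_of_mul_eq_one_left z_sq

theorem t_sq_mul (i : ℕ) (g : Cover) : t i * (t i * g) = z * g := by
  rw [← mul_assoc, t_sq]

theorem t_braid_mul (i : ℕ) (g : Cover) :
    t (i + 1) * (t i * (t (i + 1) * g)) = t i * (t (i + 1) * (t i * g)) := by
  simp only [← mul_assoc, t_braid]

theorem t_far_mul {i j : ℕ} (hij : i + 1 < j ∨ j + 1 < i) (g : Cover) :
    t j * (t i * g) = z * (t i * (t j * g)) := by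
  rw [← mul_assoc, t_far hij]
  simp only [mul_assoc]

/-- The parity of an element of the double cover, with values in the subgroup `{1, z}`. -/
def par : Cover →* Cover :=
  PresentedGroup.toGroup (rels := {w | IsRel w})
    (f := fun a => match a with | .t _ => z | .z => 1) (by
      intro r hr
      cases hr <;> simp [pow_two, z_sq, z_inv])

@[simp] theorem par_t (i : ℕ) : par (t i) = z := PresentedGroup.toGroup.of _

@[simp] theorem par_z : par z = 1 := PresentedGroup.toGroup.of _

@[simp] theorem theta_t (i : ℕ) : theta (t i) = Equiv.swap i (i + 1) := PresentedGroup.toGroup.of _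

@[simp] theorem theta_z : theta z = 1 := PresentedGroup.toGroup.of _

theorem cover_induction {p : Cover → Prop} (hz : p z) (ht : ∀ i, p (t i)) (h1 : p 1)
    (hmul : ∀ g h, p g → p h → p (g * h)) (hinv : ∀ g, p g → p g⁻¹) (g : Cover) : p g := by
  let H : Subgroup Cover :=
    { carrier := {g | p g}
      mul_mem' := fun {a b} ha hb => hmul a b ha hb
      one_mem' := h1
      inv_mem' := fun {a} ha => hinv a ha }
  refine PresentedGroup.generated_by _ H (fun a => ?_) g
  cases a with
  | t i => exact ht i
  | z => exact hz

theorem par_eq (g : Cover) : par g = 1 ∨ par g = z := by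
  induction g using cover_induction with
  | hz => simp
  | ht i => simp
  | h1 => simp
  | hmul g h hg hh =>
    rcases hg with hg | hg <;> rcases hh with hh | hh <;> simp [hg, hh, z_sq]
  | hinv g hg => rcases hg with hg | hg <;> simp [hg, z_inv]

theorem par_mul_self (g : Cover) : par g * par g = 1 := by
  rcases par_eq g with h | h <;> simp [h, z_sq]

theorem par_comm (g h : Cover) : par g * h = h * par g := by
  rcases par_eq g with e | e <;> simp [e, z_comm]

theorem par_left (g h k : Cover) : h * (par g * k) = par g * (h * k) := by
  rw [← mul_assoc, ← par_comm, mul_assoc]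

/-! ### Lifts of transpositions -/

/-- The lift `[i, j]` of the transposition `(i, j)`, for `i ≠ j`. -/
def tau (i j : ℕ) : Cover := if j < i then conjWord t (i - 1 - j) j else z * conjWord t (j - 1 - i) i

theorem tau_add (i d : ℕ) : tau (i + d + 1) i = conjWord t d i := by
  rw [tau, if_pos (by omega), show i + d + 1 - 1 - i = d by omega]

theorem tau_swap {i j : ℕ} (h : i ≠ j) : tau j i = z * tau i j := by
  rcases lt_or_gt_of_ne h with h | h
  · rw [tau, tau, if_pos h, if_neg (by omega), z_z_mul]
  · rw [tau, tau, if_pos h, if_neg (by omega)]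

/-- Since exchanging the indices only multiplies `tau` by `z`, properties are checked on the words
`conjWord`, where induction on the length is available. -/
theorem exists_tau_eq {p : ℕ → ℕ → Prop} (hp : ∀ i d, p (i + d + 1) i)
    (hs : ∀ i j, i ≠ j → p j i → p i j) {i j : ℕ} (h : i ≠ j) : p i j := by
  rcases lt_or_gt_of_ne h with h' | h'
  · obtain ⟨d, rfl⟩ := Nat.exists_eq_add_of_lt h'
    exact hs _ _ h (hp _ _)
  · obtain ⟨d, rfl⟩ := Nat.exists_eq_add_of_lt h'
    exact hp _ _

theorem theta_tau {i j : ℕ} (h : i ≠ j) : theta (tau i j) = Equiv.swap i j := by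
  refine exists_tau_eq (p := fun i j => theta (tau i j) = Equiv.swap i j) (fun i d => ?_)
    (fun i j h hp => ?_) h
  · rw [tau_add]
    induction d generalizing i with
    | zero => rw [conjWord, theta_t, Equiv.swap_comm, add_zero]
    | succ d ih =>
      rw [conjWord, map_mul, map_mul, ih, theta_t, Equiv.swap_comm i,
        show i + (d + 1) + 1 = i + 1 + d + 1 by ring, Equiv.swap_comm (i + 1 + d + 1) (i + 1),
        Equiv.swap_comm (i + 1) i, Equiv.swap_comm i (i + 1),
        Equiv.swap_comm (i + 1) (i + 1 + d + 1),
        Equiv.swap_mul_swap_mul_swap (by omega) (by omega), Equiv.swap_comm]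
  · rw [tau_swap h.symm, map_mul, theta_z, one_mul, hp, Equiv.swap_comm]

theorem par_tau {i j : ℕ} (h : i ≠ j) : par (tau i j) = z := by
  refine exists_tau_eq (p := fun i j => par (tau i j) = z) (fun i d => ?_)
    (fun i j h hp => ?_) h
  · rw [tau_add]
    induction d generalizing i with
    | zero => rw [conjWord, par_t]
    | succ d ih => rw [conjWord, map_mul, map_mul, ih, par_t, z_sq, one_mul]
  · rw [tau_swap h.symm, map_mul, par_z, one_mul, hp]

theorem tau_mul_self {i j : ℕ} (h : i ≠ j) : tau i j * tau i j = z := by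
  refine exists_tau_eq (p := fun i j => tau i j * tau i j = z) (fun i d => ?_)
    (fun i j h hp => ?_) h
  · rw [tau_add]
    induction d generalizing i with
    | zero => rw [conjWord, t_sq]
    | succ d ih =>
      rw [conjWord]
      simp only [mul_assoc, t_sq_mul, z_left]
      rw [← mul_assoc (conjWord t d (i + 1)), ih, z_left, t_sq, z_z_mul]
  · rw [tau_swap h.symm, mul_assoc, z_left, hp, z_z_mul]

theorem tau_inv {i j : ℕ} (h : i ≠ j) : (tau i j)⁻¹ = tau j i :=
  inv_eq_of_mul_eq_one_left (by rw [tau_swap h, mul_assoc, tau_mul_self h, z_sq])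

theorem t_conjWord_far {k i d : ℕ} (h : k + 1 < i ∨ i + d + 1 < k) :
    t k * conjWord t d i = z * (conjWord t d i * t k) := by
  induction d generalizing i with
  | zero => exact t_far (by omega)
  | succ d ih =>
    rw [conjWord]
    simp only [mul_assoc]
    rw [t_far_mul (by omega), ← mul_assoc (t k), ih (by omega), mul_assoc, mul_assoc, t_far (by omega)]
    simp only [z_left, z_z_mul]

/-- Conjugation by `t (i + d + 1)` moves the upper endpoint one step up, so the word grows at its
peak. The case `d = 0` is the braid relation. -/
theorem t_conjWord_last (i d : ℕ) :
    t (i + d + 1) * conjWord t d i = z * (conjWord t (d + 1) i * t (i + d + 1)) := by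
  induction d generalizing i with
  | zero =>
    simp only [conjWord, add_zero, mul_assoc]
    rw [← t_braid_mul, t_sq, ← z_comm (t i), z_left, z_z_mul]
  | succ d ih =>
    rw [conjWord, conjWord, show i + (d + 1) + 1 = i + 1 + d + 1 by ring]
    simp only [mul_assoc]
    rw [t_far_mul (by omega), ← mul_assoc (t (i + 1 + d + 1)), ih, t_far (by omega)]
    simp only [z_left, z_z_mul, mul_assoc]

/-- Both `k` and `k + 1` lie strictly between the endpoints. When `k = i + 1`, the braid relation
turns `t k` into `t i` on the way in and back on the way out, and `t i` anticommutes with the core.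
-/
theorem t_conjWord_mid {k i d : ℕ} (h : i < k) (h' : k < i + d) :
    t k * conjWord t d i = z * (conjWord t d i * t k) := by
  induction d generalizing i with
  | zero => omega
  | succ d ih =>
    rcases Nat.lt_or_ge (i + 1) k with hk | hk
    · rw [conjWord]
      simp only [mul_assoc]
      rw [t_far_mul (by omega), ← mul_assoc (t k), ih hk (by omega), t_far (by omega)]
      simp only [z_left, z_z_mul, mul_assoc]
    · obtain rfl : k = i + 1 := by omega
      obtain ⟨d, rfl⟩ : ∃ e, d = e + 1 := ⟨d - 1, by omega⟩
      rw [conjWord, conjWord]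
      simp only [mul_assoc]
      rw [t_braid_mul, ← mul_assoc (t i) (conjWord t d _), t_conjWord_far (by omega)]
      have := t_braid i
      simp only [mul_assoc] at this
      simp only [z_left, mul_assoc, this]

theorem t_mul_tau_of_lt (k i d : ℕ) :
    t k * tau (i + d + 1) i =
      z * (tau (Equiv.swap k (k + 1) (i + d + 1)) (Equiv.swap k (k + 1) i) * t k) := by
  rcases lt_trichotomy (k + 1) i with hk | rfl | hk
  · rw [Equiv.swap_apply_of_ne_of_ne (by omega) (by omega),
      Equiv.swap_apply_of_ne_of_ne (by omega) (by omega), tau_add, t_conjWord_far (by omega)]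
  · rw [Equiv.swap_apply_of_ne_of_ne (by omega) (by omega), Equiv.swap_apply_right,
      show k + 1 + d + 1 = k + (d + 1) + 1 by ring, tau_add, ← add_assoc,
      show k + d + 1 + 1 = k + 1 + d + 1 by ring, tau_add, conjWord]
    simp only [mul_assoc, t_sq, z_left, z_z_mul, ← z_comm]
  rcases eq_or_lt_of_le (Nat.le_of_lt_succ hk) with rfl | hk
  · rw [Equiv.swap_apply_left]
    cases d with
    | zero =>
      have h : tau (i + 1) i = t i := tau_add i 0
      rw [add_zero, Equiv.swap_apply_right, tau_swap (show i + 1 ≠ i by omega), h, mul_assoc,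
        z_z_mul]
    | succ d =>
      rw [Equiv.swap_apply_of_ne_of_ne (by omega) (by omega), tau_add,
        show i + (d + 1) + 1 = i + 1 + d + 1 by ring, tau_add, conjWord]
      simp only [mul_assoc, t_sq_mul]
  rcases lt_trichotomy k (i + d) with hd | rfl | hd
  · rw [Equiv.swap_apply_of_ne_of_ne (by omega) (by omega),
      Equiv.swap_apply_of_ne_of_ne (by omega) (by omega), tau_add, t_conjWord_mid hk hd]
  · obtain ⟨d, rfl⟩ : ∃ e, d = e + 1 := ⟨d - 1, by omega⟩
    rw [Equiv.swap_apply_of_ne_of_ne (x := i) (by omega) (by omega), Equiv.swap_apply_right, tau_add,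
      ← add_assoc, tau_add]
    -- Here the upper endpoint moves down: `t_conjWord_last` is multiplied by `t (i + d + 1)` on
    -- both sides and solved for the longer word.
    have h := t_conjWord_last i d
    have h2 : z * (t (i + d + 1) * (t (i + d + 1) * conjWord t d i)) * t (i + d + 1) =
      z * (t (i + d + 1) * (z * (conjWord t (d + 1) i * t (i + d + 1)))) * t (i + d + 1) := by rw [h]
    simp only [mul_assoc, t_sq_mul, z_left, z_z_mul, t_sq] at h2
    rw [h2, ← z_comm, z_left, z_z_mul]
  rcases eq_or_lt_of_le (Nat.succ_le_of_lt hd) with rfl | hd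
  · rw [Equiv.swap_apply_of_ne_of_ne (x := i) (by omega) (by omega), Nat.succ_eq_add_one,
      Equiv.swap_apply_left, tau_add, t_conjWord_last, show i + d + 1 + 1 = i + (d + 1) + 1 by ring,
      tau_add]
  · rw [Equiv.swap_apply_of_ne_of_ne (by omega) (by omega),
      Equiv.swap_apply_of_ne_of_ne (by omega) (by omega), tau_add, t_conjWord_far (by omega)]

/-- The rule is multiplicative in `g`, so the generators suffice. It replaces all later computation
with words. -/
theorem mul_tau (g : Cover) {i j : ℕ} (h : i ≠ j) :
    g * tau i j = par g * (tau (theta g i) (theta g j) * g) := by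
  induction g using cover_induction generalizing i j with
  | hz => rw [par_z, theta_z, one_mul, z_comm]; rfl
  | h1 => simp
  | ht k =>
    rw [par_t, theta_t]
    refine exists_tau_eq (p := fun i j => t k * tau i j =
      z * (tau (Equiv.swap k (k + 1) i) (Equiv.swap k (k + 1) j) * t k)) (t_mul_tau_of_lt k)
      (fun i j h hp => ?_) h
    rw [tau_swap h.symm, z_left, hp, tau_swap (i := Equiv.swap k (k + 1) j)
      (by simpa using h.symm)]
    simp only [mul_assoc, z_left]
  | hmul g k hg hk =>
    rw [mul_assoc, hk h, par_left, ← mul_assoc g, hg (by simpa using h), map_mul, map_mul]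
    simp only [mul_assoc, Equiv.Perm.mul_apply]
    rw [par_left g (par k)]
  | hinv g hg =>
    have e := hg (i := theta g⁻¹ i) (j := theta g⁻¹ j) (by simpa using h)
    have h' (i : ℕ) : theta g (theta g⁻¹ i) = i := by
      rw [← Equiv.Perm.mul_apply, ← map_mul, mul_inv_cancel, map_one, Equiv.Perm.one_apply]
    rw [h', h'] at e
    rw [inv_mul_eq_iff_eq_mul, map_inv par, inv_eq_of_mul_eq_one_left (par_mul_self g), par_left,
      ← mul_assoc g, e, mul_assoc, ← mul_assoc, par_mul_self, mul_assoc, mul_inv_cancel, mul_one,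
      one_mul]

/-! ### The central element is nontrivial -/

/-- The bilinear form on finitely supported functions for which the standard basis is orthogonal and
its vectors have square length `-1 / 2`. -/
noncomputable def rootForm : LinearMap.BilinForm ℚ (ℕ →₀ ℚ) :=
  (-1 / 2 : ℚ) • Finsupp.linearCombination ℚ (fun i => Finsupp.lapply i)

/-- The quadratic form of `rootForm`. -/
noncomputable abbrev rootQuad : QuadraticForm ℚ (ℕ →₀ ℚ) := LinearMap.BilinMap.toQuadraticMap rootForm

/-- The simple roots of the symmetric group, as elements of the Clifford algebra. -/
noncomputable def root (i : ℕ) : CliffordAlgebra rootQuad :=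
  CliffordAlgebra.ι rootQuad (Finsupp.single i 1 - Finsupp.single (i + 1) 1)

theorem rootForm_single (i j : ℕ) :
    rootForm (Finsupp.single i 1) (Finsupp.single j 1) = if i = j then -1 / 2 else 0 := by
  simp [rootForm, Finsupp.single_apply, eq_comm]

/-- The normalization `-1 / 2` makes every root square to `-1`, matching `t_i² = z` with `z` acting
as `-1`; the value `1 / 2` on adjacent roots is what `root_braid` needs. -/
theorem rootForm_root (i j : ℕ) :
    rootForm (Finsupp.single i 1 - Finsupp.single (i + 1) 1)
      (Finsupp.single j 1 - Finsupp.single (j + 1) 1) =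
    if i + 1 < j ∨ j + 1 < i then 0 else if i = j then -1 else 1 / 2 := by
  simp only [map_sub, LinearMap.sub_apply, rootForm_single]
  split_ifs <;> first | omega | norm_num

theorem root_mul_self (i : ℕ) : root i * root i = -1 := by
  rw [root, CliffordAlgebra.ι_sq_scalar, LinearMap.BilinMap.toQuadraticMap_apply, rootForm_root]
  simp

theorem root_mul_root_add (i j : ℕ) : root i * root j + root j * root i =
    algebraMap ℚ _ (if i + 1 < j ∨ j + 1 < i then 0 else if i = j then -2 else 1) := by
  rw [root, root, CliffordAlgebra.ι_mul_ι_add_swap, LinearMap.BilinMap.polar_toQuadraticMap,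
    rootForm_root, rootForm_root]
  congr 1
  split_ifs <;> first | omega | norm_num

/-- The simple roots as units of the Clifford algebra. -/
noncomputable def rootUnit (i : ℕ) : (CliffordAlgebra rootQuad)ˣ where
  val := root i
  inv := -root i
  val_inv := by rw [mul_neg, root_mul_self, neg_neg]
  inv_val := by rw [neg_mul, root_mul_self, neg_neg]

/-- With `a² = b² = -1` and `ab + ba = 1`, both `aba` and `bab` equal `a + b`. -/
theorem root_braid {i j : ℕ} (h : root i * root j + root j * root i = 1) :
    root i * root j * root i = root j * root i * root j := by
  have h1 : root i * root j = 1 - root j * root i := eq_sub_of_add_eq h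
  have h2 : root j * root i = 1 - root i * root j := eq_sub_of_add_eq' h
  rw [h1, sub_mul, mul_assoc, root_mul_self, h2, sub_mul, mul_assoc, root_mul_self]
  simp [add_comm]

/-- The basic spin representation, with values in the units of the Clifford algebra. -/
noncomputable def spinRep : Cover →* (CliffordAlgebra rootQuad)ˣ :=
  PresentedGroup.toGroup (rels := {w | IsRel w})
    (f := fun a => match a with | .t i => rootUnit i | .z => -1) (by
      intro r hr
      cases hr with
      | z_central i => simp
      | z_sq => simp
      | t_sq i =>
        simp only [map_mul, map_inv, FreeGroup.lift_apply_of, mul_inv_eq_one, pow_two]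
        exact Units.ext (root_mul_self i)
      | braid i =>
        simp only [map_mul, map_inv, FreeGroup.lift_apply_of, mul_inv_eq_one]
        exact Units.ext (root_braid (by rw [root_mul_root_add, if_neg (by omega), if_neg (by omega), map_one]))
      | far i j h =>
        simp only [map_mul, map_inv, FreeGroup.lift_apply_of, mul_inv_eq_one]
        refine Units.ext ?_
        have := root_mul_root_add i j
        rw [if_pos h, map_zero] at this
        simpa [rootUnit] using eq_neg_of_add_eq_zero_right this)

theorem z_ne_one : z ≠ 1 := by
  intro h
  have h1 : spinRep z = -1 := PresentedGroup.toGroup.of _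
  rw [h, map_one] at h1
  have h2 : (1 : CliffordAlgebra rootQuad) = -1 := congrArg Units.val h1
  have h3 : algebraMap ℚ (CliffordAlgebra rootQuad) 2 = 0 := by
    rw [map_ofNat, ← one_add_one_eq_two]
    nth_rewrite 2 [h2]
    exact add_neg_cancel 1
  exact two_ne_zero ((map_eq_zero _).mp h3)

/-! ### The finite covers -/

theorem z_mem_coverN (n : ℕ) : z ∈ coverN n := Subgroup.subset_closure (Or.inl rfl)

theorem t_mem_coverN {n i : ℕ} (h : i + 1 < n) : t i ∈ coverN n :=
  Subgroup.subset_closure (Or.inr ⟨i, h, rfl⟩)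

theorem z_mul_mem_coverN {n : ℕ} {g : Cover} : z * g ∈ coverN n ↔ g ∈ coverN n :=
  Subgroup.mul_mem_cancel_left _ (z_mem_coverN n)

theorem coverN_mono {m n : ℕ} (h : m ≤ n) : coverN m ≤ coverN n := by
  refine Subgroup.closure_mono (Set.union_subset_union_right _ ?_)
  rintro _ ⟨i, hi, rfl⟩
  exact ⟨i, by omega, rfl⟩

theorem tau_mem_coverN {n i j : ℕ} (h : i ≠ j) (hi : i < n) (hj : j < n) : tau i j ∈ coverN n := by
  refine exists_tau_eq (p := fun i j => i < n → j < n → tau i j ∈ coverN n) (fun i d hi _ => ?_)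
    (fun i j h hp hi hj => ?_) h hi hj
  · rw [tau_add]
    induction d generalizing i with
    | zero => exact t_mem_coverN hi
    | succ d ih =>
      exact mul_mem (mul_mem (t_mem_coverN (by omega)) (ih (i + 1) (by omega) (by omega)))
        (t_mem_coverN (by omega))
  · rw [tau_swap h.symm]
    exact z_mul_mem_coverN.mpr (hp hj hi)

theorem theta_apply_of_le {n : ℕ} {g : Cover} (hg : g ∈ coverN n) {k : ℕ} (hk : n ≤ k) :
    theta g k = k := by
  induction hg using Subgroup.closure_induction with
  | mem g hg =>
    rcases hg with rfl | ⟨i, hi, rfl⟩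
    · simp
    · rw [theta_t, Equiv.swap_apply_of_ne_of_ne (by omega) (by omega)]
  | one => simp
  | mul g h _ _ hg hh => rw [map_mul, Equiv.Perm.mul_apply, hh, hg]
  | inv g _ hg => rw [map_inv, Equiv.Perm.inv_eq_iff_eq, hg]

theorem theta_lt_iff {n : ℕ} {g : Cover} (hg : g ∈ coverN n) {k : ℕ} : theta g k < n ↔ k < n := by
  constructor <;> intro h <;> by_contra hk
  · rw [theta_apply_of_le hg (not_lt.mp hk)] at h
    exact hk h
  · have := (theta g).injective (theta_apply_of_le hg (not_lt.mp hk))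
    rw [this] at hk
    exact hk h

/-- Coset decomposition: in the second case `j` is the point that `g` sends to `n`. The union of
these cosets is stable under right multiplication by the generators. -/
theorem coverN_succ {n : ℕ} {g : Cover} (hg : g ∈ coverN (n + 1)) :
    g ∈ coverN n ∨ ∃ j < n, ∃ h ∈ coverN n, g = h * tau n j := by
  have key (g : Cover) (hg : g ∈ coverN n ∨ ∃ j < n, ∃ h ∈ coverN n, g = h * tau n j) (y : Cover)
      (hy : y = z ∨ ∃ i, i + 1 < n + 1 ∧ y = t i) :
      g * y ∈ coverN n ∨ ∃ j < n, ∃ h ∈ coverN n, g * y = h * tau n j := by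
    rcases hy with rfl | ⟨i, hi, rfl⟩
    · rw [← z_comm]
      rcases hg with hg | ⟨j, hj, h, hh, rfl⟩
      · exact Or.inl (z_mul_mem_coverN.mpr hg)
      · exact Or.inr ⟨j, hj, z * h, z_mul_mem_coverN.mpr hh, (mul_assoc _ _ _).symm⟩
    have hti : t i = tau (i + 1) i := (tau_add i 0).symm
    rcases Nat.lt_or_ge (i + 1) n with hin | hin
    · rcases hg with hg | ⟨j, hj, h, hh, rfl⟩
      · exact Or.inl (mul_mem hg (t_mem_coverN hin))
      · refine Or.inr ⟨Equiv.swap i (i + 1) j, ?_, h * (z * t i), mul_mem hh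
          (z_mul_mem_coverN.mpr (t_mem_coverN hin)), ?_⟩
        · rw [Equiv.swap_apply_def]
          split_ifs <;> omega
        · have hne : n ≠ Equiv.swap i (i + 1) j := by
            rw [Equiv.swap_apply_def]
            split_ifs <;> omega
          rw [mul_assoc h (z * t i), mul_assoc z, mul_tau (t i) hne, par_t, theta_t,
            Equiv.swap_apply_self, z_z_mul, Equiv.swap_apply_of_ne_of_ne (by omega) (by omega),
            mul_assoc]
    · obtain rfl : n = i + 1 := by omega
      rw [hti]
      rcases hg with hg | ⟨j, hj, h, hh, rfl⟩
      · exact Or.inr ⟨i, by omega, g, hg, rfl⟩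
      · rcases eq_or_ne j i with rfl | hji
        · refine Or.inl ?_
          rw [mul_assoc, tau_mul_self (by omega)]
          exact mul_mem hh (z_mem_coverN _)
        · refine Or.inr ⟨j, hj, h * (z * tau j i), mul_mem hh (z_mul_mem_coverN.mpr
            (tau_mem_coverN hji hj (by omega))), ?_⟩
          rw [mul_assoc, mul_tau _ (by omega), par_tau (by omega), theta_tau (by omega),
            Equiv.swap_apply_left, Equiv.swap_apply_of_ne_of_ne (by omega) (by omega)]
          simp only [mul_assoc]
  have tinv (i : ℕ) : (t i)⁻¹ = z * t i :=
    inv_eq_of_mul_eq_one_left (by rw [mul_assoc, t_sq, z_sq])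
  induction hg using Subgroup.closure_induction_right with
  | one => exact Or.inl (one_mem _)
  | mul_right g _ y hy hg => exact key g hg y (by simpa using hy)
  | mul_inv_cancel g _ y hy hg =>
    rcases hy with rfl | ⟨i, hi, rfl⟩
    · rw [z_inv]
      exact key g hg z (Or.inl rfl)
    · rw [tinv, ← mul_assoc]
      exact key _ (key g hg z (Or.inl rfl)) _ (Or.inr ⟨i, hi, rfl⟩)

theorem coverN_zero {g : Cover} (hg : g ∈ coverN 0) : g = 1 ∨ g = z := by
  induction hg using Subgroup.closure_induction with
  | mem g hg =>
    rcases hg with rfl | ⟨i, hi, rfl⟩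
    · simp
    · omega
  | one => simp
  | mul g h _ _ hg hh => rcases hg with rfl | rfl <;> rcases hh with rfl | rfl <;> simp [z_sq]
  | inv g _ hg => rcases hg with rfl | rfl <;> simp [z_inv]

/-- Elements of the nontrivial cosets in `coverN_succ` move the point `j`, so the kernel descends to
`coverN n`. -/
theorem eq_one_or_z_of_theta_eq_one {n : ℕ} {g : Cover} (hg : g ∈ coverN n) (h : theta g = 1) :
    g = 1 ∨ g = z := by
  induction n with
  | zero => exact coverN_zero hg
  | succ n ih =>
    rcases coverN_succ hg with hg | ⟨j, hj, k, hk, rfl⟩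
    · exact ih hg
    · have h1 : theta (k * tau n j) j = j := by rw [h]; rfl
      rw [map_mul, theta_tau (by omega), Equiv.Perm.mul_apply, Equiv.swap_apply_right,
        theta_apply_of_le hk le_rfl] at h1
      omega

theorem eq_or_eq_z_mul {n : ℕ} {g h : Cover} (hg : g ∈ coverN n) (hh : h ∈ coverN n)
    (e : theta g = theta h) : g = h ∨ g = z * h := by
  rcases eq_one_or_z_of_theta_eq_one (mul_mem hg (inv_mem hh)) (by
    rw [map_mul, map_inv, e, mul_inv_cancel]) with h | h
  · exact Or.inl (mul_inv_eq_one.mp h)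
  · exact Or.inr (mul_inv_eq_iff_eq_mul.mp h)

theorem finite_coverN (n : ℕ) : (coverN n : Set Cover).Finite := by
  induction n with
  | zero => exact ((Set.finite_singleton z).insert 1).subset fun g hg => coverN_zero hg
  | succ n ih =>
    refine (ih.union ((Finset.range n).finite_toSet.biUnion fun j _ =>
      ih.image fun h => h * tau n j)).subset fun g hg => ?_
    rcases coverN_succ hg with hg | ⟨j, hj, k, hk, rfl⟩
    · exact Or.inl hg
    · exact Or.inr (Set.mem_biUnion (by simpa using hj) ⟨k, hk, rfl⟩)

theorem exists_theta_eq (n : ℕ) (p : Equiv.Perm {k // k < n}) :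
    ∃ s ∈ coverN n, ∀ k : {k // k < n}, theta s (k : ℕ) = p k := by
  induction p using Equiv.Perm.swap_induction_on with
  | one => exact ⟨1, one_mem _, by simp⟩
  | swap_mul p a b hab ih =>
    obtain ⟨s, hs, h⟩ := ih
    have hab' : (a : ℕ) ≠ b := fun e => hab (Subtype.ext e)
    refine ⟨tau a b * s, mul_mem (tau_mem_coverN hab' a.2 b.2) hs, fun k => ?_⟩
    rw [map_mul, Equiv.Perm.mul_apply, h, theta_tau hab', Equiv.Perm.mul_apply,
      Equiv.swap_apply_def, Equiv.swap_apply_def, apply_ite Subtype.val, apply_ite Subtype.val]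
    simp only [Subtype.ext_iff]

/-! ### Lifts of cycles -/

theorem z_pow_left (k : ℕ) (g h : Cover) : g * (z ^ k * h) = z ^ k * (g * h) := by
  rw [← mul_assoc, ((show Commute z g from z_comm g).pow_left k).symm.eq, mul_assoc]

theorem z_pow_z_pow_mul (k : ℕ) (g : Cover) : z ^ k * (z ^ k * g) = g := by
  rw [← mul_assoc, ← pow_add, ← two_mul, pow_mul, pow_two, z_sq, one_pow, one_mul]

theorem z_pow_of_even {k : ℕ} (h : Even k) : z ^ k = 1 := by
  obtain ⟨m, rfl⟩ := h
  rw [← two_mul, pow_mul, pow_two, z_sq, one_pow]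

theorem z_pow_of_odd {k : ℕ} (h : Odd k) : z ^ k = z := by
  obtain ⟨m, rfl⟩ := h
  rw [pow_succ, z_pow_of_even (even_two_mul m), one_mul]

/-- The product of the lifts of the transpositions of `a` with the elements of a list. -/
def star (a : ℕ) (l : List ℕ) : Cover := (l.map (tau a)).prod

@[simp] theorem star_nil (a : ℕ) : star a [] = 1 := rfl

theorem star_cons (a b : ℕ) (l : List ℕ) : star a (b :: l) = tau a b * star a l := by
  simp [star]

theorem star_append (a : ℕ) (l l' : List ℕ) : star a (l ++ l') = star a l * star a l' := by
  simp [star]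

theorem mul_star (g : Cover) {a : ℕ} {l : List ℕ} (h : a ∉ l) :
    g * star a l = par g ^ l.length * (star (theta g a) (l.map (theta g)) * g) := by
  induction l with
  | nil => simp
  | cons b l ih =>
    rw [List.mem_cons, not_or] at h
    rw [star_cons, ← mul_assoc, mul_tau g h.1, mul_assoc, mul_assoc, ih h.2, List.map_cons, star_cons,
      List.length_cons, pow_succ', mul_assoc]
    rcases par_eq g with e | e
    · simp only [e, one_pow, one_mul, mul_assoc]
    · rw [e, z_pow_left, mul_assoc]

theorem mul_star_of_fixed (g : Cover) {a : ℕ} {l : List ℕ} (h : a ∉ l)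
    (hg : ∀ x ∈ a :: l, theta g x = x) :
    g * star a l = par g ^ l.length * (star a l * g) := by
  have : l.map (theta g) = l := by
    conv_rhs => rw [← List.map_id l]
    exact List.map_congr_left fun x hx => hg x (List.mem_cons_of_mem _ hx)
  rw [mul_star g h, hg a List.mem_cons_self, this]

theorem par_star {a : ℕ} {l : List ℕ} (h : a ∉ l) : par (star a l) = z ^ l.length := by
  induction l with
  | nil => simp
  | cons b l ih =>
    rw [List.mem_cons, not_or] at h
    rw [star_cons, map_mul, par_tau h.1, ih h.2, List.length_cons, pow_succ']

theorem theta_star_apply {a : ℕ} {l : List ℕ} (h : a ∉ l) {x : ℕ} (hx : x ∉ a :: l) :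
    theta (star a l) x = x := by
  induction l with
  | nil => simp
  | cons b l ih =>
    simp only [List.mem_cons, not_or] at h hx
    rw [star_cons, map_mul, Equiv.Perm.mul_apply, ih h.2 (by simp [hx]), theta_tau h.1,
      Equiv.swap_apply_of_ne_of_ne hx.1 hx.2.1]

theorem star_mem_coverN {n a : ℕ} {l : List ℕ} (h : a ∉ l) (hl : ∀ x ∈ a :: l, x < n) :
    star a l ∈ coverN n := by
  refine list_prod_mem fun g hg => ?_
  obtain ⟨b, hb, rfl⟩ := List.mem_map.mp hg
  exact tau_mem_coverN (fun e => h (e ▸ hb)) (hl a (by simp)) (hl b (by simp [hb]))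

theorem tau_mul_star {c a b : ℕ} {l : List ℕ} (hca : c ≠ a) (h : b ∉ l) (hc : c ∉ b :: l)
    (ha : a ∉ b :: l) : tau c a * star b l = z ^ l.length * (star b l * tau c a) := by
  rw [mul_star_of_fixed _ h, par_tau hca]
  intro x hx
  rw [theta_tau hca, Equiv.swap_apply_of_ne_of_ne]
  · rintro rfl
    exact hc hx
  · rintro rfl
    exact ha hx

/-- Pushing `tau a b` to the right end turns the centre `a` of the remaining star into `b`; this
takes the first point out of a cycle. -/
theorem star_cons_eq {a b : ℕ} {l : List ℕ} (h : (a :: b :: l).Nodup) :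
    star a (b :: l) = z ^ l.length * (star b l * tau a b) := by
  simp only [List.nodup_cons, List.mem_cons, not_or] at h
  have hl : l.map (Equiv.swap a b) = l := by
    conv_rhs => rw [← List.map_id l]
    refine List.map_congr_left fun x hx => Equiv.swap_apply_of_ne_of_ne ?_ ?_
    · rintro rfl
      exact h.1.2 hx
    · rintro rfl
      exact h.2.1 hx
  rw [star_cons, mul_star _ h.1.2, par_tau h.1.1, theta_tau h.1.1, Equiv.swap_apply_left, hl]

/-- The factorization behind cutting a cycle. Two signs `z ^ v.length` arise and cancel, so only the
length of `u` is left. -/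
theorem star_append_cons {n b j : ℕ} {u v : List ℕ} (h : (n :: b :: (u ++ j :: v)).Nodup) :
    star n (b :: (u ++ j :: v)) =
      z ^ u.length * (star b u * (star j v * (tau n b * tau n j))) := by
  have h1 : (n :: b :: u).Nodup := h.sublist (by simp)
  have h2 : (n :: j :: v).Nodup := h.sublist (by
    refine List.Sublist.cons_cons _ (List.Sublist.cons _ ?_)
    exact List.sublist_append_right _ _)
  have h3 : b ∉ j :: v := by
    simp only [List.nodup_cons, List.mem_append, not_or] at h
    exact h.2.1.2
  rw [← List.cons_append, star_append, star_cons_eq h1, star_cons_eq h2]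
  have h4 : tau n b * star j v = z ^ v.length * (star j v * tau n b) := by
    simp only [List.nodup_cons] at h1 h2
    exact tau_mul_star (by simp at h1; tauto) h2.2.1 h2.1 h3
  rw [mul_assoc, mul_assoc, z_pow_left v.length (tau n b), ← mul_assoc (tau n b), h4,
    mul_assoc (z ^ v.length), mul_assoc (star j v), z_pow_z_pow_mul]

/-- The exponent is odd only if both factors are, and then the cycle length `u.length + v.length +
2` is even. Hence lifts of odd cycles do not depend on the starting point. -/
theorem star_rotate {a j : ℕ} {u v : List ℕ} (h : (a :: (u ++ j :: v)).Nodup) :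
    star a (u ++ j :: v) = z ^ ((u.length + 1) * (v.length + 1)) * star j (v ++ a :: u) := by
  have h1 : (a :: j :: v).Nodup := h.sublist (by simp)
  have h2 : (j :: a :: u).Nodup := by
    refine List.Perm.nodup (l := a :: (u ++ [j])) ?_ (h.sublist (by simp))
    rw [← List.cons_append]
    exact List.perm_append_singleton _ _
  have h3 : a ∉ u := by simp at h2; tauto
  have h4 : j ∉ v := by simp at h1; tauto
  have h5 : ∀ x ∈ j :: v, x ∉ a :: u := by
    rw [← List.cons_append, List.nodup_append] at h
    intro x hx hx'
    exact h.2.2 x hx' x hx rfl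
  have h6 : star a u * star j v = z ^ (u.length * v.length) * (star j v * star a u) := by
    rw [mul_star_of_fixed _ h4 fun x hx => theta_star_apply h3 (h5 x hx), par_star h3, pow_mul]
  have hja : j ≠ a := by simp at h2; tauto
  have h7 : star a u * tau a j = z ^ (u.length + 1) * star j (a :: u) := by
    rw [star_cons_eq h2, tau_swap hja, z_left, pow_succ, mul_assoc, z_left, z_pow_left, z_left (z ^ u.length),
      z_pow_z_pow_mul]
  rw [star_append, star_cons_eq h1, z_pow_left, ← mul_assoc (star a u), h6, star_append, mul_assoc,
    mul_assoc, h7, z_pow_left _ (star j v), ← mul_assoc, ← mul_assoc, ← pow_add, ← pow_add]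
  congr 2
  ring

/-! ### Products of lifts of disjoint cycles -/

/-- A lift of the cycle `b ↦ a`, `c ↦ b`, … for a list `[a, b, c, …]`. -/
def cyc : List ℕ → Cover
  | [] => 1
  | a :: l => star a l

/-- The product of the lifts of the cycles in a list. -/
def prodCyc (L : List (List ℕ)) : Cover := (L.map cyc).prod

@[simp] theorem prodCyc_nil : prodCyc [] = 1 := rfl

@[simp] theorem prodCyc_cons (l : List ℕ) (L : List (List ℕ)) :
    prodCyc (l :: L) = cyc l * prodCyc L := by
  simp [prodCyc]

theorem prodCyc_append (L L' : List (List ℕ)) : prodCyc (L ++ L') = prodCyc L * prodCyc L' := by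
  simp [prodCyc]

theorem theta_cyc_apply {l : List ℕ} (h : l.Nodup) {x : ℕ} (hx : x ∉ l) : theta (cyc l) x = x := by
  cases l with
  | nil => simp [cyc]
  | cons a l => exact theta_star_apply (List.nodup_cons.mp h).1 hx

theorem theta_prodCyc_apply {L : List (List ℕ)} (h : L.flatten.Nodup) {x : ℕ} (hx : x ∉ L.flatten) :
    theta (prodCyc L) x = x := by
  induction L with
  | nil => simp
  | cons l L ih =>
    simp only [List.flatten_cons, List.mem_append, not_or, List.nodup_append] at h hx
    rw [prodCyc_cons, map_mul, Equiv.Perm.mul_apply, ih h.2.1 hx.2, theta_cyc_apply h.1 hx.1]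

theorem cyc_mem_coverN {n : ℕ} {l : List ℕ} (h : l.Nodup) (hl : ∀ x ∈ l, x < n) :
    cyc l ∈ coverN n := by
  cases l with
  | nil => exact one_mem _
  | cons a l => exact star_mem_coverN (List.nodup_cons.mp h).1 hl

theorem prodCyc_mem_coverN {n : ℕ} {L : List (List ℕ)} (h : L.flatten.Nodup)
    (hL : ∀ x ∈ L.flatten, x < n) : prodCyc L ∈ coverN n := by
  induction L with
  | nil => exact one_mem _
  | cons l L ih =>
    simp only [List.flatten_cons, List.mem_append, List.nodup_append] at h hL
    exact mul_mem (cyc_mem_coverN h.1 fun x hx => hL x (Or.inl hx))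
      (ih h.2.1 fun x hx => hL x (Or.inr hx))

/-- A cycle of odd length is a product of evenly many `tau`, so the parity signs cancel. -/
theorem mul_cyc (g : Cover) {l : List ℕ} (h : l.Nodup) (hl : l = [] ∨ Odd l.length) :
    g * cyc l = cyc (l.map (theta g)) * g := by
  cases l with
  | nil => simp [cyc]
  | cons a l =>
    rw [cyc, mul_star g (List.nodup_cons.mp h).1]
    have : Even l.length := by
      simpa [Nat.odd_add_one] using hl
    obtain ⟨k, hk⟩ := this
    rw [hk, ← two_mul, pow_mul, pow_two, par_mul_self, one_pow, one_mul]
    rfl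

theorem mul_prodCyc (g : Cover) {L : List (List ℕ)} (h : L.flatten.Nodup)
    (hL : ∀ l ∈ L, Odd l.length) :
    g * prodCyc L = prodCyc (L.map (List.map (theta g))) * g := by
  induction L with
  | nil => simp
  | cons l L ih =>
    simp only [List.flatten_cons, List.nodup_append] at h
    rw [prodCyc_cons, ← mul_assoc, mul_cyc g h.1 (Or.inr (hL l (by simp))), mul_assoc,
      ih h.2.1 fun l hl => hL l (by simp [hl])]
    simp [mul_assoc]

/-- The list `L` of nonempty lists is a list of cycles partitioning the points `0, …, n - 1`. -/
structure Covers (n : ℕ) (L : List (List ℕ)) : Prop where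
  perm : L.flatten.Perm (List.range n)
  ne_nil : ∀ l ∈ L, l ≠ []

theorem Covers.nodup {n : ℕ} {L : List (List ℕ)} (h : Covers n L) : L.flatten.Nodup :=
  h.perm.nodup_iff.mpr List.nodup_range

theorem Covers.mem_iff {n : ℕ} {L : List (List ℕ)} (h : Covers n L) {x : ℕ} :
    x ∈ L.flatten ↔ x < n := by
  rw [h.perm.mem_iff, List.mem_range]

theorem Covers.prodCyc_mem {n : ℕ} {L : List (List ℕ)} (h : Covers n L) : prodCyc L ∈ coverN n :=
  prodCyc_mem_coverN h.nodup fun _ hx => h.mem_iff.mp hx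

/-- The number of top degree factorizations of a cycle of the given length. -/
def weight (k : ℕ) : ℕ := if Odd k then catalan (k / 2) else 0

/-- The product of the weights of the cycles. -/
def listWeight (L : List (List ℕ)) : ℕ := (L.map fun l => weight l.length).prod

theorem weight_of_even {k : ℕ} (h : Even k) : weight k = 0 := if_neg (Nat.not_odd_iff_even.mpr h)

theorem catalan_pos (k : ℕ) : 0 < catalan k := by
  have h := succ_mul_catalan_eq_centralBinom k
  have h' := Nat.centralBinom_pos k
  rw [← h] at h'
  exact Nat.pos_of_mul_pos_left h'

/-- Two products of cycles agree, up to a sign if some cycle has even length. -/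
def SameCyc (L L' : List (List ℕ)) : Prop :=
  listWeight L = listWeight L' ∧
    (prodCyc L = prodCyc L' ∨ listWeight L = 0 ∧ prodCyc L = z * prodCyc L')

theorem SameCyc.trans {L L' L'' : List (List ℕ)} (h : SameCyc L L') (h' : SameCyc L' L'') :
    SameCyc L L'' := by
  obtain ⟨h1, h2⟩ := h
  obtain ⟨h3, h4⟩ := h'
  refine ⟨h1.trans h3, ?_⟩
  rcases h2 with h2 | ⟨e, h2⟩ <;> rcases h4 with h4 | ⟨e', h4⟩
  · exact Or.inl (h2.trans h4)
  · exact Or.inr ⟨h1.trans e', h2.trans h4⟩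
  · exact Or.inr ⟨e, by rw [h2, h4]⟩
  · exact Or.inl (by rw [h2, h4, z_z_mul])

/-- A sign can appear only for a cycle of even length, and then the total weight is zero;
`sameCyc_front` rests on the same fact. -/
theorem sameCyc_rotate {a j : ℕ} {u v : List ℕ} (L : List (List ℕ))
    (h : (a :: (u ++ j :: v)).Nodup) :
    SameCyc ((a :: (u ++ j :: v)) :: L) ((j :: (v ++ a :: u)) :: L) := by
  have hlen : (j :: (v ++ a :: u)).length = (a :: (u ++ j :: v)).length := by
    simp; omega
  refine ⟨by simp only [listWeight, List.map_cons, hlen], ?_⟩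
  simp only [prodCyc_cons, cyc]
  rw [star_rotate h]
  rcases Nat.even_or_odd ((u.length + 1) * (v.length + 1)) with he | ho
  · left
    rw [z_pow_of_even he, one_mul]
  · right
    rw [z_pow_of_odd ho, mul_assoc]
    refine ⟨?_, rfl⟩
    have : Even (a :: (u ++ j :: v)).length := by
      have := (Nat.odd_mul.mp ho).1.add_odd (Nat.odd_mul.mp ho).2
      rwa [show u.length + 1 + (v.length + 1) = (a :: (u ++ j :: v)).length by
        simp only [List.length_cons, List.length_append]; omega] at this
    rw [listWeight, List.map_cons, List.prod_cons, weight_of_even this, zero_mul]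

theorem sameCyc_front {L₁ L₂ : List (List ℕ)} {l : List ℕ} (h : (L₁ ++ l :: L₂).flatten.Nodup) :
    SameCyc (L₁ ++ l :: L₂) (l :: (L₁ ++ L₂)) := by
  refine ⟨?_, ?_⟩
  · simp only [listWeight, List.map_append, List.map_cons, List.prod_append, List.prod_cons]
    ring
  simp only [List.flatten_append, List.flatten_cons, List.nodup_append, List.mem_append] at h
  have hfix (x : ℕ) (hx : x ∈ l) : theta (prodCyc L₁) x = x :=
    theta_prodCyc_apply h.1 fun hx' => h.2.2 x hx' x (Or.inl hx) rfl
  rw [prodCyc_append, prodCyc_cons, prodCyc_cons, prodCyc_append, ← mul_assoc, ← mul_assoc]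
  cases l with
  | nil => simp [cyc]
  | cons a l =>
    have := mul_star_of_fixed (prodCyc L₁) (List.nodup_cons.mp h.2.1.1).1 hfix
    rw [cyc, this]
    rcases Nat.even_or_odd l.length with he | ho
    · left
      obtain ⟨k, hk⟩ := he
      rw [hk, ← two_mul, pow_mul, pow_two, par_mul_self, one_pow, one_mul]
    · rcases par_eq (prodCyc L₁) with e | e
      · left
        rw [e, one_pow, one_mul]
      · right
        refine ⟨?_, by rw [e, z_pow_of_odd ho, mul_assoc]⟩
        have : Even (a :: l).length := by simpa using ho.add_one
        simp only [listWeight, List.map_append, List.map_cons, List.prod_append, List.prod_cons,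
          weight_of_even this, zero_mul, mul_zero]

theorem Covers.of_perm {n : ℕ} {L L' : List (List ℕ)} (h : Covers n L)
    (hp : L'.flatten.Perm L.flatten) (h' : ∀ l ∈ L', l ≠ []) : Covers n L' :=
  ⟨hp.trans h.perm, h'⟩

theorem exists_front {L : List (List ℕ)} (h : L.flatten.Nodup) {j : ℕ} (hj : j ∈ L.flatten) :
    ∃ l L', ((j :: l) :: L').flatten.Perm L.flatten ∧ (∀ l' ∈ L', l' ∈ L) ∧
      L'.length + 1 = L.length ∧ SameCyc L ((j :: l) :: L') := by
  obtain ⟨l, hl, hjl⟩ := List.mem_flatten.mp hj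
  obtain ⟨L₁, L₂, rfl⟩ := List.append_of_mem hl
  have h1 := sameCyc_front h
  have hc : (l :: (L₁ ++ L₂)).flatten.Perm (L₁ ++ l :: L₂).flatten := by
    simp only [List.flatten_cons, List.flatten_append, ← List.append_assoc]
    exact List.perm_append_comm.append_right _
  have hlen : (L₁ ++ L₂).length + 1 = (L₁ ++ l :: L₂).length := by
    simp only [List.length_append, List.length_cons, add_assoc]
  have hmem : ∀ l' ∈ L₁ ++ L₂, l' ∈ L₁ ++ l :: L₂ := fun l' hl' => by
    simp only [List.mem_cons, List.mem_append] at hl' ⊢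
    tauto
  cases l with
  | nil => simp at hjl
  | cons a l =>
    rcases eq_or_ne j a with rfl | hja
    · exact ⟨l, L₁ ++ L₂, hc, hmem, hlen, h1⟩
    obtain ⟨u, v, rfl⟩ := List.append_of_mem (List.mem_of_ne_of_mem hja hjl)
    have hnd : (a :: (u ++ j :: v)).Nodup := by
      have := hc.nodup_iff.mpr h
      rw [List.flatten_cons, List.nodup_append] at this
      exact this.1
    refine ⟨v ++ a :: u, L₁ ++ L₂, List.Perm.trans ?_ hc, hmem, hlen,
      h1.trans (sameCyc_rotate _ hnd)⟩
    rw [List.flatten_cons, List.flatten_cons]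
    refine List.Perm.append_right _ ?_
    rw [← List.cons_append, ← List.cons_append]
    exact List.perm_append_comm

theorem Covers.exists_front {n : ℕ} {L : List (List ℕ)} (h : Covers n L) {j : ℕ} (hj : j < n) :
    ∃ l L', Covers n ((j :: l) :: L') ∧ (L'.length + 1 = L.length) ∧
      SameCyc L ((j :: l) :: L') := by
  obtain ⟨l, L', hp, hm, hlen, hs⟩ := SpinSym.exists_front h.nodup (h.mem_iff.mpr hj)
  refine ⟨l, L', h.of_perm hp fun l' hl' => ?_, hlen, hs⟩
  rcases List.mem_cons.mp hl' with rfl | hl'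
  · simp
  · exact h.ne_nil l' (hm l' hl')

/-! ### Equality up to sign, and decomposition into disjoint cycles -/

/-- Equality up to multiplication by the central element `z`. -/
def PM (g h : Cover) : Prop := g = h ∨ g = z * h

theorem PM.symm {g h : Cover} (e : PM g h) : PM h g := by
  rcases e with rfl | rfl
  · exact Or.inl rfl
  · exact Or.inr (z_z_mul _).symm

theorem PM.trans {g h k : Cover} (e : PM g h) (e' : PM h k) : PM g k := by
  rcases e with rfl | rfl
  · exact e'
  · rcases e' with rfl | rfl
    · exact Or.inr rfl
    · exact Or.inl (z_z_mul _)

theorem PM.mul_left {g h : Cover} (e : PM g h) (k : Cover) : PM (k * g) (k * h) := by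
  rcases e with rfl | rfl
  · exact Or.inl rfl
  · exact Or.inr (z_left _ _)

theorem PM.mul_right {g h : Cover} (e : PM g h) (k : Cover) : PM (g * k) (h * k) := by
  rcases e with rfl | rfl
  · exact Or.inl rfl
  · exact Or.inr (mul_assoc _ _ _)

theorem pm_par_mul (g h : Cover) : PM (par g * h) h := by
  rcases par_eq g with e | e <;> rw [e]
  · exact Or.inl (one_mul h)
  · exact Or.inr rfl

theorem pm_z_pow_mul (k : ℕ) (h : Cover) : PM (z ^ k * h) h := by
  rcases Nat.even_or_odd k with e | e
  · exact Or.inl (by rw [z_pow_of_even e, one_mul])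
  · exact Or.inr (by rw [z_pow_of_odd e])

theorem SameCyc.pm {L L' : List (List ℕ)} (h : SameCyc L L') : PM (prodCyc L) (prodCyc L') :=
  h.2.imp_right And.right

theorem pm_mul_tau {g : Cover} {i j : ℕ} (h : i ≠ j) (hi : theta g i = i) (hj : theta g j = j) :
    PM (g * tau i j) (tau i j * g) := by
  rw [mul_tau g h, hi, hj]
  exact pm_par_mul _ _

theorem covers_zero : Covers 0 [] := ⟨by simp, by simp⟩

theorem Covers.succ {n : ℕ} {L : List (List ℕ)} (h : Covers n L) : Covers (n + 1) ([n] :: L) := by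
  refine ⟨?_, ?_⟩
  · rw [List.range_succ, List.flatten_cons]
    exact List.perm_append_comm.trans (h.perm.append_right _)
  · intro l hl
    rcases List.mem_cons.mp hl with rfl | hl
    · simp
    · exact h.ne_nil l hl

/-- Induction along the cosets of `coverN_succ`: with the cycle of `j` written so as to start at
`j`, a factor `tau n j` appends `n` at its end. -/
theorem exists_prodCyc {n : ℕ} {g : Cover} (hg : g ∈ coverN n) :
    ∃ L, Covers n L ∧ PM g (prodCyc L) := by
  induction n generalizing g with
  | zero => exact ⟨[], covers_zero, by simpa [PM] using coverN_zero hg⟩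
  | succ n ih =>
    rcases coverN_succ hg with hg | ⟨j, hj, k, hk, rfl⟩
    · obtain ⟨L, hL, e⟩ := ih hg
      exact ⟨[n] :: L, hL.succ, by simpa [cyc] using e⟩
    · obtain ⟨L, hL, e⟩ := ih hk
      obtain ⟨l, L', hL', -, hs⟩ := hL.exists_front hj
      have hc : Covers (n + 1) ((j :: (l ++ [n])) :: L') := by
        refine hL'.succ.of_perm ?_ ?_
        · simp only [List.flatten_cons, ← List.append_assoc, ← List.cons_append]
          exact List.perm_append_comm.append_right _
        · intro l' hl'
          rcases List.mem_cons.mp hl' with rfl | hl'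
          · simp
          · exact hL'.ne_nil l' (by simp [hl'])
      refine ⟨_, hc, ((e.trans hs.pm).mul_right _).trans ?_⟩
      have hnd := hc.nodup
      rw [List.flatten_cons, List.nodup_append] at hnd
      have h1 := theta_prodCyc_apply hnd.2.1 (x := n) fun h => hnd.2.2 n (by simp) n h rfl
      have h2 := theta_prodCyc_apply hnd.2.1 (x := j) fun h => hnd.2.2 j (by simp) j h rfl
      rw [prodCyc_cons, prodCyc_cons, mul_assoc]
      refine ((pm_mul_tau (by omega) h1 h2).mul_left _).trans ?_
      simp only [cyc, star_append, star_cons, star_nil, mul_one, mul_assoc]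
      rw [tau_swap (show n ≠ j by omega), mul_assoc]
      refine PM.mul_left (Or.inr ?_) _
      rw [z_z_mul]

/-! ### The spin group algebra -/

/-- The auxiliary point `n` disappears, so Jucys–Murphy elements formed for different `n` agree. -/
theorem cycle_pair {n i k : ℕ} (hi : i < n) (hk : k < n) (h : i ≠ k) : cycle n [i, k] = tau i k := by
  have hx {j : ℕ} (hj : j < n) : x n j = tau n j := by rw [tau, if_pos hj]; rfl
  simp only [cycle, List.reverse_singleton, List.map_cons, List.map_nil, List.prod_singleton, hx hi,
    hx hk]
  rw [mul_tau (tau n i) (show n ≠ k by omega), par_tau (by omega), theta_tau (by omega),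
    Equiv.swap_apply_left,
    Equiv.swap_apply_of_ne_of_ne (by omega) (by omega), mul_assoc, mul_assoc,
    tau_mul_self (by omega), ← z_comm, z_z_mul]

section Algebra

variable (R : Type*) [CommRing R]

theorem im_mul (g h : Cover) : im R (g * h) = im R g * im R h := by
  simp only [im, map_mul]

theorem im_one : im R 1 = 1 := by
  simp only [im, map_one]

theorem coeff_mk (g : Cover) (a : MonoidAlgebra R Cover) :
    coeff R g (Ideal.Quotient.mk (spinIdeal R) a) = a.coeff g - a.coeff (z * g) := rfl

theorem coeff_mul_im (g h : Cover) (a : SpinAlg R) : coeff R g (a * im R h) = coeff R (g * h⁻¹) a := by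
  obtain ⟨a, rfl⟩ := Ideal.Quotient.mk_surjective a
  rw [im, ← map_mul, coeff_mk, coeff_mk, MonoidAlgebra.of_apply, MonoidAlgebra.coeff_mul_single_apply,
    MonoidAlgebra.coeff_mul_single_apply, mul_one, mul_one, mul_assoc]

theorem coeff_z_mul (g : Cover) (a : SpinAlg R) : coeff R (z * g) a = -coeff R g a := by
  obtain ⟨a, rfl⟩ := Ideal.Quotient.mk_surjective a
  rw [coeff_mk, coeff_mk, z_z_mul, neg_sub]

theorem coeff_smul (g : Cover) (r : R) (a : SpinAlg R) : coeff R g (r • a) = r * coeff R g a := by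
  obtain ⟨a, rfl⟩ := Ideal.Quotient.mk_surjective a
  rw [← Ideal.Quotient.mkₐ_eq_mk R, ← map_smul, Ideal.Quotient.mkₐ_eq_mk, coeff_mk, coeff_mk,
    MonoidAlgebra.coeff_smul_apply, MonoidAlgebra.coeff_smul_apply, smul_eq_mul, smul_eq_mul, mul_sub]

theorem coeff_im_self (g : Cover) : coeff R g (im R g) = 1 := by
  rw [im, coeff_mk, MonoidAlgebra.of_apply, MonoidAlgebra.coeff_single, Finsupp.single_eq_same,
    Finsupp.single_eq_of_ne, sub_zero]
  exact fun h => z_ne_one (mul_eq_right.mp h)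

theorem coeff_im_of_not_pm {g h : Cover} (e : ¬PM g h) : coeff R g (im R h) = 0 := by
  rw [PM, not_or] at e
  rw [im, coeff_mk, MonoidAlgebra.of_apply, MonoidAlgebra.coeff_single, Finsupp.single_eq_of_ne e.1,
    Finsupp.single_eq_of_ne, sub_zero]
  intro h'
  exact e.2 (by rw [← h', z_z_mul])

theorem im_z_mul (g : Cover) : im R (z * g) = -im R g := by
  rw [im_mul, eq_neg_iff_add_eq_zero, ← add_one_mul]
  have : im R z + 1 = 0 := by
    rw [im, ← map_one (Ideal.Quotient.mk (spinIdeal R)), ← map_add]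
    exact Ideal.Quotient.eq_zero_iff_mem.mpr (Ideal.subset_span rfl)
  rw [this, zero_mul]

/-- The spin group algebra of the symmetric group on the points `0, …, n - 1`. -/
noncomputable def spinSpan (n : ℕ) : Submodule R (SpinAlg R) :=
  Submodule.span R (im R '' coverN n)

variable {R}

theorem im_mem_spinSpan {n : ℕ} {g : Cover} (hg : g ∈ coverN n) : im R g ∈ spinSpan R n :=
  Submodule.subset_span ⟨g, hg, rfl⟩

theorem spinSpan_mono {m n : ℕ} (h : m ≤ n) : spinSpan R m ≤ spinSpan R n :=
  Submodule.span_mono (Set.image_mono (coverN_mono h))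

theorem mul_im_mem_spinSpan {n : ℕ} {g : Cover} (hg : g ∈ coverN n) {a : SpinAlg R}
    (ha : a ∈ spinSpan R n) : a * im R g ∈ spinSpan R n := by
  induction ha using Submodule.span_induction with
  | mem a ha =>
    obtain ⟨h, hh, rfl⟩ := ha
    rw [← im_mul]
    exact im_mem_spinSpan (mul_mem hh hg)
  | zero => simp
  | add a b _ _ ha hb => rw [add_mul]; exact add_mem ha hb
  | smul r a _ ha => rw [smul_mul_assoc]; exact Submodule.smul_mem _ _ ha

theorem coeff_eq_zero_of_span {s : Set Cover} {g : Cover} (hg : ∀ h ∈ s, ¬PM g h) {a : SpinAlg R}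
    (ha : a ∈ Submodule.span R (im R '' s)) : coeff R g a = 0 := by
  induction ha using Submodule.span_induction with
  | mem a ha =>
    obtain ⟨h, hh, rfl⟩ := ha
    exact coeff_im_of_not_pm R (hg h hh)
  | zero => simp
  | add a b _ _ ha hb => rw [map_add, ha, hb, add_zero]
  | smul r a _ ha => rw [coeff_smul, ha, mul_zero]

theorem PM.mem_coverN {n : ℕ} {g h : Cover} (e : PM g h) (hh : h ∈ coverN n) : g ∈ coverN n := by
  rcases e with rfl | rfl
  · exact hh
  · exact z_mul_mem_coverN.mpr hh

theorem coeff_eq_zero_of_notMem {n : ℕ} {g : Cover} (hg : g ∉ coverN n) {a : SpinAlg R}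
    (ha : a ∈ spinSpan R n) : coeff R g a = 0 :=
  coeff_eq_zero_of_span (fun _ hh e => hg (e.mem_coverN hh)) ha

theorem coeff_eq_zero_of_pm {g h : Cover} (e : PM g h) {a : SpinAlg R} (ha : coeff R h a = 0) :
    coeff R g a = 0 := by
  rcases e with rfl | rfl
  · exact ha
  · rw [coeff_z_mul, ha, neg_zero]

variable (R)

theorem jucysMurphy_sq {n k : ℕ} (hk : k < n) : jucysMurphy R n k ^ 2 =
    ∑ i ∈ Finset.range k, ∑ j ∈ Finset.range k, im R (tau i k * tau j k) := by
  have : jucysMurphy R n k = ∑ i ∈ Finset.range k, im R (tau i k) := by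
    refine Finset.sum_congr rfl fun i hi => ?_
    rw [Finset.mem_range] at hi
    rw [cycle_pair (by omega) hk (by omega)]
  rw [this, pow_two, Finset.sum_mul_sum]
  simp only [im_mul]

theorem sort_insert_max {s : Finset ℕ} {n : ℕ} (h : ∀ k ∈ s, k < n) :
    (insert n s).sort (· ≤ ·) = s.sort (· ≤ ·) ++ [n] := by
  refine (List.Perm.eq_of_pairwise' (r := (· ≤ ·)) (Finset.pairwise_sort _ _) ?_ ?_)
  · rw [List.pairwise_append]
    refine ⟨Finset.pairwise_sort _ _, List.pairwise_singleton _ _, fun a ha b hb => ?_⟩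
    rw [List.mem_singleton] at hb
    rw [Finset.mem_sort] at ha
    exact hb ▸ (h a ha).le
  · rw [← Multiset.coe_eq_coe, Finset.sort_eq, ← Multiset.coe_add, Finset.sort_eq,
      Finset.insert_val_of_notMem fun hn => lt_irrefl n (h n hn), add_comm]
    rfl

theorem elemSymm_zero (n : ℕ) : elemSymm R 0 n = 1 := by
  simp [elemSymm]

theorem elemSymm_succ_zero (r : ℕ) : elemSymm R (r + 1) 0 = 0 := by
  rw [elemSymm, Finset.range_zero, Finset.powersetCard_eq_empty.mpr (by simp), Finset.sum_empty]

/-- The index sets are sorted by whether they contain `n`. In increasing order the factor of `n`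
stands last, and the double sum is the expansion of its square. -/
theorem elemSymm_succ_succ (r n : ℕ) : elemSymm R (r + 1) (n + 1) =
    elemSymm R (r + 1) n + ∑ i ∈ Finset.range n, ∑ j ∈ Finset.range n,
      elemSymm R r n * im R (tau i n * tau j n) := by
  have hM (s : Finset ℕ) (hs : s ⊆ Finset.range n) :
      ((s.sort (· ≤ ·)).map fun k => jucysMurphy R (n + 1) k ^ 2) =
        (s.sort (· ≤ ·)).map fun k => jucysMurphy R n k ^ 2 := by
    refine List.map_congr_left fun k hk => ?_
    rw [Finset.mem_sort] at hk
    have := Finset.mem_range.mp (hs hk)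
    rw [jucysMurphy_sq R this, jucysMurphy_sq R (by omega)]
  simp only [← Finset.mul_sum]
  rw [← jucysMurphy_sq R (Nat.lt_succ_self n), elemSymm, Finset.range_add_one,
    Finset.powersetCard_succ_insert Finset.notMem_range_self, Finset.sum_union, Finset.sum_image]
  · congr 1
    · exact Finset.sum_congr rfl fun s hs => by rw [hM s (Finset.mem_powersetCard.mp hs).1]
    · rw [elemSymm, Finset.sum_mul]
      refine Finset.sum_congr rfl fun s hs => ?_
      have hs := (Finset.mem_powersetCard.mp hs).1
      rw [sort_insert_max fun k hk => Finset.mem_range.mp (hs hk), List.map_append, List.prod_append,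
        hM s hs, List.map_singleton, List.prod_singleton]
  · intro s hs s' hs' e
    have hs := (Finset.mem_powersetCard.mp hs).1
    have hs' := (Finset.mem_powersetCard.mp hs').1
    have h1 : n ∉ s := fun h => Finset.notMem_range_self (hs h)
    have h2 : n ∉ s' := fun h => Finset.notMem_range_self (hs' h)
    have e : insert n s = insert n s' := e
    rw [← Finset.erase_insert h1, e, Finset.erase_insert h2]
  · rw [Finset.disjoint_left]
    intro s hs hs'
    obtain ⟨s', -, rfl⟩ := Finset.mem_image.mp hs'
    exact Finset.notMem_range_self ((Finset.mem_powersetCard.mp hs).1 (Finset.mem_insert_self n s'))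

theorem elemSymm_mem_spinSpan (r n : ℕ) : elemSymm R r n ∈ spinSpan R n := by
  induction n generalizing r with
  | zero =>
    cases r with
    | zero => rw [elemSymm_zero, ← im_one]; exact im_mem_spinSpan (one_mem _)
    | succ r => rw [elemSymm_succ_zero]; exact zero_mem _
  | succ n ih =>
    cases r with
    | zero => rw [elemSymm_zero, ← im_one]; exact im_mem_spinSpan (one_mem _)
    | succ r =>
      rw [elemSymm_succ_succ]
      refine add_mem (spinSpan_mono n.le_succ (ih _)) (sum_mem fun i hi => sum_mem fun j hj => ?_)
      rw [Finset.mem_range] at hi hj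
      exact mul_im_mem_spinSpan (mul_mem (tau_mem_coverN (by omega) (by omega) (by omega))
        (tau_mem_coverN (by omega) (by omega) (by omega))) (spinSpan_mono n.le_succ (ih _))

theorem coeff_elemSymm_succ_succ (r n : ℕ) (g : Cover) : coeff R g (elemSymm R (r + 1) (n + 1)) =
    coeff R g (elemSymm R (r + 1) n) + ∑ i ∈ Finset.range n, ∑ j ∈ Finset.range n,
      coeff R (g * (tau i n * tau j n)⁻¹) (elemSymm R r n) := by
  simp only [elemSymm_succ_succ, map_add, map_sum, coeff_mul_im]

end Algebra

/-! ### The coefficients of the elementary symmetric functions -/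

theorem sum_range_two_mul_add_one {f : ℕ → ℕ} (hf : ∀ q, Odd q → f q = 0) (k : ℕ) :
    ∑ q ∈ Finset.range (2 * k + 1), f q = ∑ i ∈ Finset.range (k + 1), f (2 * i) := by
  induction k with
  | zero => simp
  | succ k ih =>
    rw [show 2 * (k + 1) + 1 = 2 * k + 1 + 1 + 1 by ring, Finset.sum_range_succ,
      Finset.sum_range_succ, ih, hf (2 * k + 1) ⟨k, rfl⟩, Finset.sum_range_succ _ (k + 1), add_zero]
    rfl

theorem weight_odd (k : ℕ) : weight (2 * k + 1) = catalan k := by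
  rw [weight, if_pos ⟨k, rfl⟩]
  congr 1
  omega

/-- The Catalan recurrence for odd `m`. For even `m` the two lengths add up to the odd number `m +
1`, so one of them is even and every term vanishes. -/
theorem weight_add_two (m : ℕ) :
    weight (m + 2) = ∑ q ∈ Finset.range m, weight (q + 1) * weight (m - 1 - q + 1) := by
  rcases Nat.even_or_odd m with hm | ⟨k, rfl⟩
  · rw [weight_of_even (hm.add even_two), Finset.sum_eq_zero]
    intro q hq
    rw [Finset.mem_range] at hq
    rcases Nat.even_or_odd (q + 1) with h | h
    · rw [weight_of_even h, zero_mul]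
    · have : Even (m - 1 - q + 1) := by
        rw [Nat.even_iff] at *
        rw [Nat.odd_iff] at h
        omega
      rw [weight_of_even this, mul_zero]
  · rw [sum_range_two_mul_add_one, show 2 * k + 1 + 2 = 2 * (k + 1) + 1 by ring, weight_odd,
      catalan_succ, Finset.sum_range]
    · refine Finset.sum_congr rfl fun i _ => ?_
      rw [weight_odd, show 2 * k + 1 - 1 - 2 * (i : ℕ) + 1 = 2 * (k - i) + 1 by omega, weight_odd]
    · intro q hq
      rw [weight_of_even hq.add_one, zero_mul]

/-- Converts a sum over the points of a cycle into a sum over cutting positions, the shape of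
`weight_add_two`. -/
theorem sum_map_of_split {M : Type*} [AddCommMonoid M] {l : List ℕ} {F : ℕ → M} {f : ℕ → ℕ → M}
    (h : ∀ u j v, l = u ++ j :: v → F j = f u.length v.length) :
    (l.map F).sum = ∑ q ∈ Finset.range l.length, f q (l.length - 1 - q) := by
  induction l generalizing f with
  | nil => simp
  | cons a l ih =>
    rw [List.map_cons, List.sum_cons, List.length_cons, Finset.sum_range_succ', add_comm,
      h [] a l rfl, ih (f := fun q p => f (q + 1) p) fun u j v e => h (a :: u) j v (by simp [e])]
    congr 1
    refine Finset.sum_congr rfl fun q hq => ?_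
    congr 1
    omega

theorem Covers.length_add_le {n : ℕ} {l : List ℕ} {L : List (List ℕ)} (h : Covers n (l :: L)) :
    l.length + L.length ≤ n := by
  have h1 := h.perm.length_eq
  rw [List.length_range, List.flatten_cons, List.length_append] at h1
  have h2 : ∀ L : List (List ℕ), (∀ l ∈ L, l ≠ []) → L.length ≤ L.flatten.length := by
    intro L hL
    induction L with
    | nil => simp
    | cons l L ih =>
      have := List.length_pos_iff.mpr (hL l (by simp))
      have := ih fun l hl => hL l (by simp [hl])
      simp only [List.flatten_cons, List.length_append, List.length_cons]
      omega
  have := h2 L fun l hl => h.ne_nil l (by simp [hl])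
  omega

theorem Covers.perm_tail {n : ℕ} {l : List ℕ} {L : List (List ℕ)} (h : Covers (n + 1) ((n :: l) :: L)) :
    (l ++ L.flatten).Perm (List.range n) := by
  have h1 := h.perm
  rw [List.range_succ, List.flatten_cons, List.cons_append] at h1
  exact List.perm_cons n |>.mp (h1.trans (List.perm_append_singleton _ _))

theorem tau_swap_mul_tau_swap {i j k l : ℕ} (h : i ≠ j) (h' : k ≠ l) :
    tau j i * tau l k = tau i j * tau k l := by
  rw [tau_swap h, tau_swap h', mul_assoc, z_left, z_z_mul]

/-! ### Deleting the largest point from its cycle -/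

section Step

variable {n b : ℕ} {l : List ℕ} {L : List (List ℕ)}

theorem theta_prodCyc_front (h : Covers (n + 1) ((n :: b :: l) :: L)) :
    theta (prodCyc ((n :: b :: l) :: L)) b = n := by
  have h1 := h.nodup
  rw [List.flatten_cons, List.nodup_append] at h1
  obtain ⟨h1, h2, h3⟩ := h1
  have hb : theta (prodCyc L) b = b := theta_prodCyc_apply h2 fun hb => h3 b (by simp) b hb rfl
  have hnb : n ≠ b := by simp at h1; tauto
  rw [prodCyc_cons, cyc, star_cons_eq h1, map_mul, map_mul, map_mul, map_pow, theta_z, one_pow, one_mul,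
    Equiv.Perm.mul_apply, Equiv.Perm.mul_apply, hb, theta_tau hnb, Equiv.swap_apply_right]
  have h4 : n ∉ b :: l := (List.nodup_cons.mp h1).1
  exact theta_star_apply (List.nodup_cons.mp (List.nodup_cons.mp h1).2).1 h4

theorem prodCyc_front_notMem (h : Covers (n + 1) ((n :: b :: l) :: L)) :
    prodCyc ((n :: b :: l) :: L) ∉ coverN n := by
  intro hg
  have h1 := theta_prodCyc_front h
  have hb : b < n := by
    have h2 := h.perm_tail.mem_iff (a := b)
    simpa using h2
  have h2 := (theta_lt_iff hg).mpr hb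
  omega

/-- An element of `coverN n` must fix `n`. As the product sends `b` to `n`, the two transpositions
together must send `b` to `n`, which forces `i = b` and `j ≠ b`. -/
theorem prodCyc_front_mul_notMem (h : Covers (n + 1) ((n :: b :: l) :: L)) {i j : ℕ} (hi : i < n)
    (hj : j < n) (hij : i ≠ b ∨ j = b) :
    prodCyc ((n :: b :: l) :: L) * (tau i n * tau j n)⁻¹ ∉ coverN n := by
  intro hg
  have h1 := theta_prodCyc_front h
  have hb : b < n := by
    have h2 := h.perm_tail.mem_iff (a := b)
    simpa using h2
  have h2 : ∀ x, theta (prodCyc ((n :: b :: l) :: L) * (tau i n * tau j n)⁻¹)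
      (Equiv.swap i n (Equiv.swap j n x)) = theta (prodCyc ((n :: b :: l) :: L)) x := by
    intro x
    rw [← theta_tau (show i ≠ n by omega), ← theta_tau (show j ≠ n by omega),
      ← Equiv.Perm.mul_apply, ← Equiv.Perm.mul_apply, ← map_mul, ← map_mul, mul_assoc, mul_assoc, inv_mul_cancel, mul_one]
  have h3 := h2 b
  rw [h1] at h3
  have h4 : ¬ Equiv.swap i n (Equiv.swap j n b) < n := fun hlt => by
    have := (theta_lt_iff hg).mpr hlt
    omega
  apply h4
  rw [Equiv.swap_apply_def, Equiv.swap_apply_def]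
  split_ifs <;> omega

theorem prodCyc_front_split {u v : List ℕ} {j : ℕ}
    (h : Covers (n + 1) ((n :: b :: (u ++ j :: v)) :: L)) :
    prodCyc ((n :: b :: (u ++ j :: v)) :: L) * (tau b n * tau j n)⁻¹ =
      z ^ u.length * prodCyc ((b :: u) :: (j :: v) :: L) := by
  have h1 := h.nodup
  rw [List.flatten_cons, List.nodup_append] at h1
  obtain ⟨h1, h2, h3⟩ := h1
  have hfix (x : ℕ) (hx : x ∈ n :: b :: (u ++ j :: v)) : theta (prodCyc L) x = x :=
    theta_prodCyc_apply h2 fun hb => h3 x hx x hb rfl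
  have hnb : n ≠ b := by simp at h1; tauto
  have hnj : n ≠ j := by simp at h1; tauto
  rw [mul_inv_eq_iff_eq_mul]
  simp only [prodCyc_cons, cyc]
  rw [star_append_cons h1, tau_swap_mul_tau_swap hnb.symm hnj.symm]
  have h4 : tau b n * tau j n * prodCyc L = prodCyc L * (tau b n * tau j n) := by
    rw [← mul_assoc (prodCyc L), mul_tau (prodCyc L) hnb.symm, hfix b (by simp), hfix n (by simp),
      mul_assoc (par _), mul_assoc (tau b n) (prodCyc L), mul_tau (prodCyc L) hnj.symm,
      hfix j (by simp), hfix n (by simp), par_left, ← mul_assoc (par _), par_mul_self, one_mul,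
      mul_assoc]
  simp only [mul_assoc] at h4 ⊢
  rw [h4]

/-- Here `j` lies in a cycle other than that of `n`, and the two cycles merge. The sign is not
tracked because the coefficient will vanish for reasons of degree. -/
theorem prodCyc_front_join {j : ℕ} {v : List ℕ} {L' : List (List ℕ)}
    (h : Covers (n + 1) ((n :: b :: l) :: L)) (hp : ((j :: v) :: L').flatten.Perm L.flatten)
    (hs : SameCyc L ((j :: v) :: L')) :
    PM (prodCyc ((n :: b :: l) :: L) * (tau b n * tau j n)⁻¹)
      (prodCyc ((j :: (v ++ b :: l)) :: L')) := by
  have hnd : ((n :: b :: l) ++ ((j :: v) ++ L'.flatten)).Nodup := by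
    have := h.nodup
    rw [List.flatten_cons] at this
    exact (hp.append_left _).nodup_iff.mpr this
  rw [List.nodup_append, List.nodup_append] at hnd
  obtain ⟨h1, ⟨h2, h3, h4⟩, h5⟩ := hnd
  have hnb : n ≠ b := by simp at h1; tauto
  have hnj : n ≠ j := h5 n (by simp) j (by simp)
  have hbj : b ≠ j := h5 b (by simp) j (by simp)
  have hbl : b ∉ l := by simp at h1; tauto
  have hjv : j ∉ v := (List.nodup_cons.mp h2).1
  have hjbl : (j :: b :: l).Nodup := List.nodup_cons.mpr
    ⟨fun hj => h5 j (List.mem_cons_of_mem _ hj) j (by simp) rfl, (List.nodup_cons.mp h1).2⟩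
  have hX (x : ℕ) (hx : x ∈ n :: b :: l) : theta (prodCyc ((j :: v) :: L')) x = x := by
    refine theta_prodCyc_apply ?_ fun hx' => ?_
    · rw [List.flatten_cons, List.nodup_append]
      exact ⟨h2, h3, h4⟩
    · exact h5 x hx x (by simpa using hx') rfl
  have hY (x : ℕ) (hx : x ∉ L'.flatten) : theta (prodCyc L') x = x := theta_prodCyc_apply h3 hx
  have e1 : PM (prodCyc ((n :: b :: l) :: L))
      (star b l * (prodCyc ((j :: v) :: L') * tau n b)) := by
    rw [prodCyc_cons, cyc, star_cons_eq h1, mul_assoc, mul_assoc]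
    refine (pm_z_pow_mul _ _).trans (PM.mul_left ?_ _)
    exact (hs.pm.mul_left _).trans (pm_mul_tau hnb (hX n (by simp)) (hX b (by simp))).symm
  refine (e1.mul_right _).trans ?_
  -- All transpositions involving `n` collapse to the single one that glues the two cycles.
  have e2 : PM (tau n b * (tau b n * tau j n)⁻¹) (tau j b) := by
    rw [mul_inv_rev, tau_inv hnj.symm, tau_inv hnb.symm, ← mul_assoc, mul_tau _ hnj, par_tau hnb,
      theta_tau hnb, Equiv.swap_apply_left, Equiv.swap_apply_of_ne_of_ne hnj.symm hbj.symm, mul_assoc,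
      mul_assoc, tau_mul_self hnb, ← z_comm, z_z_mul, tau_swap hbj.symm]
    exact Or.inr rfl
  rw [mul_assoc, mul_assoc]
  refine ((e2.mul_left _).mul_left _).trans ?_
  rw [prodCyc_cons, prodCyc_cons, cyc, cyc, mul_assoc]
  have e3 := pm_mul_tau (g := prodCyc L') hbj.symm
    (hY j fun hj => h4 j (by simp) j hj rfl)
    (hY b fun hb => h5 b (by simp) b (by simp [hb]) rfl)
  refine ((e3.mul_left _).mul_left _).trans ?_
  rw [← mul_assoc, ← mul_assoc, star_append]
  refine PM.mul_right ?_ _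
  have e4 : PM (star b l * star j v) (star j v * star b l) := by
    rw [mul_star_of_fixed _ hjv fun x hx => theta_star_apply hbl
      fun hx' => h5 x (List.mem_cons_of_mem _ hx') x (List.mem_append_left _ hx) rfl, par_star hbl, ← pow_mul]
    exact pm_z_pow_mul _ _
  refine (e4.mul_right _).trans ?_
  rw [mul_assoc, star_cons_eq hjbl]
  exact (pm_z_pow_mul _ _).symm.mul_left _

end Step

/-! ### The induction computing the top-degree coefficients -/

section Coefficients

variable (R : Type*) [CommRing R]

/-- The coefficient of `prodCyc L` in `elemSymm R r n`, if `2 * r + L.length ≤ n`. -/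
def expected (r n : ℕ) (L : List (List ℕ)) : R := if 2 * r + L.length = n then (listWeight L : R) else 0

variable {R}

theorem coeff_eq_expected_of_sameCyc {r n : ℕ} {L L' : List (List ℕ)} (hs : SameCyc L L')
    (hlen : L'.length = L.length) {a : SpinAlg R} (h : coeff R (prodCyc L') a = expected R r n L') :
    coeff R (prodCyc L) a = expected R r n L := by
  have e : expected R r n L = expected R r n L' := by rw [expected, expected, hlen, hs.1]
  rcases hs.2 with h' | ⟨h0, h'⟩
  · rw [h', h, e]
  · have h1 : expected R r n L = 0 := by
      rw [expected, h0, Nat.cast_zero, ite_self]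
    rw [h', coeff_z_mul, h, ← e, h1, neg_zero]

theorem expected_split (r n : ℕ) (b : ℕ) (u v : List ℕ) (j : ℕ) (L : List (List ℕ)) :
    expected R r n ((b :: u) :: (j :: v) :: L) = if 2 * r + (L.length + 2) = n then
      ((weight (u.length + 1) * weight (v.length + 1) * listWeight L : ℕ) : R) else 0 := by
  simp only [expected, listWeight, List.map_cons, List.prod_cons, List.length_cons, mul_assoc]

/-- If `u` has odd length, the cycle `b :: u` has even length and weight zero, so the sign from
`prodCyc_front_split` is harmless. -/
theorem coeff_z_pow_mul_of_expected {r n : ℕ} {b : ℕ} {u : List ℕ} {L : List (List ℕ)}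
    {a : SpinAlg R} {g : Cover} (h : coeff R g a = expected R r n ((b :: u) :: L)) :
    coeff R (z ^ u.length * g) a = expected R r n ((b :: u) :: L) := by
  rcases Nat.even_or_odd u.length with hu | hu
  · rw [z_pow_of_even hu, one_mul, h]
  · have h0 : expected R r n ((b :: u) :: L) = 0 := by
      rw [expected, listWeight, List.map_cons, List.prod_cons, weight_of_even (by simpa using hu.add_one),
        zero_mul, Nat.cast_zero, ite_self]
    rw [z_pow_of_odd hu, coeff_z_mul, h, h0, neg_zero]

theorem sum_expected_split (r n : ℕ) (b : ℕ) (l : List ℕ) (L : List (List ℕ)) {F : ℕ → R}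
    (hF : ∀ u j v, l = u ++ j :: v → F j = expected R r n ((b :: u) :: (j :: v) :: L)) :
    (l.map F).sum = expected R (r + 1) (n + 1) ((n :: b :: l) :: L) := by
  rw [sum_map_of_split (f := fun p q => if 2 * r + (L.length + 2) = n then
      ((weight (p + 1) * weight (q + 1) * listWeight L : ℕ) : R) else 0)
      fun u j v e => by rw [hF u j v e, expected_split]]
  rw [expected, List.length_cons]
  by_cases h : 2 * r + (L.length + 2) = n
  · have e : listWeight ((n :: b :: l) :: L) = weight (l.length + 2) * listWeight L := by
      simp [listWeight]
    simp only [if_pos h]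
    rw [if_pos (by omega), ← Nat.cast_sum, ← Finset.sum_mul, e, weight_add_two]
  · simp only [if_neg h]
    rw [if_neg (by omega), Finset.sum_const_zero]

variable (R)

/-- The top degree coefficients of `elemSymm R r n`. -/
theorem coeff_elemSymm (n r : ℕ) {L : List (List ℕ)} (hL : Covers n L) (hr : 2 * r + L.length ≤ n) :
    coeff R (prodCyc L) (elemSymm R r n) = expected R r n L := by
  induction n generalizing r L with
  | zero =>
    obtain rfl : r = 0 := by omega
    obtain rfl : L = [] := List.length_eq_zero_iff.mp (by omega)
    rw [elemSymm_zero, prodCyc_nil, ← im_one, coeff_im_self]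
    simp [expected, listWeight]
  | succ n ih =>
    -- The cycle of the largest point is put first and rotated to start there; it is then `[n]` or
    -- `n :: b :: l`.
    obtain ⟨l, L', hL', hlen, hs⟩ := hL.exists_front n.lt_succ_self
    refine coeff_eq_expected_of_sameCyc hs hlen ?_
    rw [← hlen] at hr
    clear hs hlen hL L
    rename' L' => L, hL' => hL
    have htail := hL.perm_tail
    have hne : ∀ l' ∈ L, l' ≠ [] := fun l' hl' => hL.ne_nil l' (List.mem_cons_of_mem _ hl')
    cases l with
    | nil =>
      have hc : Covers n L := ⟨htail, hne⟩
      have e : prodCyc ([n] :: L) = prodCyc L := by simp [cyc]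
      have e' (r : ℕ) : expected R r (n + 1) ([n] :: L) = expected R r n L := by
        have h1 : weight 1 = 1 := (weight_odd 0).trans catalan_zero
        simp only [expected, listWeight, List.map_cons, List.prod_cons, List.length_nil, zero_add,
          h1, one_mul, List.length_cons, ← add_assoc, Nat.add_right_cancel_iff]
      rw [e, e']
      cases r with
      | zero => rw [elemSymm_zero, ← elemSymm_zero R n, ih 0 hc (by omega)]
      | succ r =>
        rw [coeff_elemSymm_succ_succ, ih (r + 1) hc (by omega), add_eq_left]
        refine Finset.sum_eq_zero fun i hi => Finset.sum_eq_zero fun j hj => ?_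
        rw [Finset.mem_range] at hi hj
        rcases eq_or_ne i j with rfl | hij
        -- Equal indices give only a sign, and `2 * r + L.length < n` puts the element above the top
        -- degree of `elemSymm R r n`.
        · rw [tau_mul_self (by omega), z_inv, ← z_comm, coeff_z_mul, ih r hc (by omega), expected,
            if_neg (by omega), neg_zero]
        · refine coeff_eq_zero_of_notMem (fun hg => ?_) (elemSymm_mem_spinSpan R r n)
          rw [Subgroup.mul_mem_cancel_left _ hc.prodCyc_mem, inv_mem_iff] at hg
          have := theta_apply_of_le hg le_rfl
          rw [map_mul, Equiv.Perm.mul_apply, theta_tau (by omega), theta_tau (by omega),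
            Equiv.swap_apply_right, Equiv.swap_apply_of_ne_of_ne (by omega) (by omega)] at this
          omega
    | cons b l =>
      have h0 := coeff_eq_zero_of_notMem (prodCyc_front_notMem hL) (elemSymm_mem_spinSpan R r n)
      cases r with
      | zero =>
        rw [elemSymm_zero, ← elemSymm_zero R n, h0, expected, if_neg]
        have := hL.length_add_le
        simp only [List.length_cons] at this ⊢
        omega
      | succ r =>
        rw [coeff_elemSymm_succ_succ, h0, zero_add]
        have hb : b < n := by
          have := htail.mem_iff (a := b)
          simpa using this
        rw [Finset.sum_eq_single b]
        rotate_left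
        · intro i hi hib
          rw [Finset.mem_range] at hi
          refine Finset.sum_eq_zero fun j hj => ?_
          rw [Finset.mem_range] at hj
          exact coeff_eq_zero_of_notMem (prodCyc_front_mul_notMem hL hi hj (Or.inl hib))
            (elemSymm_mem_spinSpan R r n)
        · intro hb'
          exact absurd (Finset.mem_range.mpr hb) hb'
        set F : ℕ → R := fun j => coeff R (prodCyc ((n :: b :: l) :: L) * (tau b n * tau j n)⁻¹)
          (elemSymm R r n) with hF
        have hFb : F b = 0 := coeff_eq_zero_of_notMem (prodCyc_front_mul_notMem hL hb hb (Or.inr rfl))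
          (elemSymm_mem_spinSpan R r n)
        have hFL : ∀ j ∈ L.flatten, F j = 0 := by
          intro j hj
          have hnd : L.flatten.Nodup := (List.nodup_append.mp
            (htail.nodup_iff.mpr List.nodup_range)).2.1
          obtain ⟨v, L', hp, hm, hlen, hs⟩ := exists_front hnd hj
          refine coeff_eq_zero_of_pm (prodCyc_front_join hL hp hs) ?_
          have hc : Covers n ((j :: (v ++ b :: l)) :: L') := by
            refine ⟨List.Perm.trans ?_ htail, ?_⟩
            · refine List.Perm.trans ?_ (hp.append_left (b :: l))
              rw [List.flatten_cons, List.flatten_cons, ← List.append_assoc, ← List.cons_append]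
              exact List.perm_append_comm.append_right _
            · intro l' hl'
              rcases List.mem_cons.mp hl' with rfl | hl'
              · simp
              · exact hne l' (hm l' hl')
          have hr : 2 * (r + 1) + (L.length + 1) ≤ n + 1 := hr
          -- After merging there are `L.length` cycles on `n` points, too few for degree `2 * r`.
          rw [ih r hc (by rw [List.length_cons]; omega), expected, List.length_cons, if_neg (by omega)]
        -- The points below `n` are `b`, those of `l` and those of `L`; only those of `l`
        -- contribute.
        have hsum : ∑ j ∈ Finset.range n, F j = (l.map F).sum := by
          have h1 : ∑ j ∈ Finset.range n, F j = ((List.range n).map F).sum := by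
            rw [← List.sum_toFinset _ List.nodup_range, List.toFinset_range]
          rw [h1, ← (htail.map F).sum_eq, List.map_append, List.sum_append, List.map_cons, List.sum_cons,
            hFb, zero_add, List.sum_eq_zero (l := L.flatten.map F), add_zero]
          intro x hx
          obtain ⟨j, hj, rfl⟩ := List.mem_map.mp hx
          exact hFL j hj
        rw [hsum]
        refine sum_expected_split r n b l L fun u j v e => ?_
        subst e
        simp only [hF]
        rw [prodCyc_front_split hL]
        refine coeff_z_pow_mul_of_expected (ih r ⟨?_, ?_⟩ ?_)
        · simpa using htail
        · intro l' hl'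
          simp only [List.mem_cons] at hl'
          rcases hl' with rfl | rfl | hl'
          · simp
          · simp
          · exact hne l' hl'
        · simp only [List.length_cons] at hr ⊢
          omega

end Coefficients

/-! ### Cycle types -/

/-- `star_cons_eq` peels transpositions off on the right and `formPerm` on the left, hence the
inverse. It does not affect cycle types. -/
theorem theta_cyc {l : List ℕ} (h : l.Nodup) : theta (cyc l) = l.formPerm⁻¹ := by
  cases l with
  | nil => simp [cyc]
  | cons a l =>
    induction l generalizing a with
    | nil => simp [cyc]
    | cons b l ih =>
      have hab : a ≠ b := by simp at h; tauto
      rw [cyc, star_cons_eq h, map_mul, map_mul, map_pow, theta_z, one_pow, one_mul, theta_tau hab,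
        List.formPerm_cons_cons, mul_inv_rev, Equiv.swap_inv, ← ih b (List.nodup_cons.mp h).2, cyc]

theorem formPerm_map_apply {α β : Type*} [DecidableEq α] [DecidableEq β] {f : α → β}
    (hf : Function.Injective f) (l : List α) (x : α) :
    (l.map f).formPerm (f x) = f (l.formPerm x) := by
  cases l with
  | nil => simp
  | cons a l =>
    induction l generalizing a x with
    | nil => simp
    | cons b l ih =>
      rw [List.map_cons, List.map_cons, List.formPerm_cons_cons, List.formPerm_cons_cons,
        Equiv.Perm.mul_apply, Equiv.Perm.mul_apply, ← List.map_cons, ih, hf.map_swap]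

theorem formPerm_inv_map_apply {α β : Type*} [DecidableEq α] [DecidableEq β] {f : α → β}
    (hf : Function.Injective f) (l : List α) (x : α) :
    (l.map f).formPerm⁻¹ (f x) = f (l.formPerm⁻¹ x) := by
  rw [← List.formPerm_reverse, ← List.formPerm_reverse, ← List.map_reverse, formPerm_map_apply hf]

theorem theta_prodCyc_val_apply {n : ℕ} (L : List (List {k // k < n}))
    (h : (L.map (List.map Subtype.val)).flatten.Nodup) (x : {k // k < n}) :
    theta (prodCyc (L.map (List.map Subtype.val))) x =
      ((L.map fun l => l.formPerm⁻¹).prod x : {k // k < n}) := by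
  induction L with
  | nil => simp
  | cons l L ih =>
    rw [List.map_cons, List.flatten_cons, List.nodup_append] at h
    rw [List.map_cons, prodCyc_cons, map_mul, Equiv.Perm.mul_apply, ih h.2.1, theta_cyc h.1,
      formPerm_inv_map_apply Subtype.val_injective, List.map_cons, List.prod_cons,
      Equiv.Perm.mul_apply]

theorem cycleType_formPerm_of_nodup {α : Type*} [Fintype α] [DecidableEq α] {l : List α}
    (h : l.Nodup) : l.formPerm.cycleType = if 2 ≤ l.length then {l.length} else 0 := by
  split_ifs with h2
  · rw [(List.isCycle_formPerm h h2).cycleType, List.support_formPerm_of_nodup l h,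
      List.toFinset_card_of_nodup h]
    rintro x rfl
    simp at h2
  · rw [Equiv.Perm.cycleType_eq_zero, List.formPerm_eq_one_iff _ h]
    omega

theorem cycleType_prod_formPerm {α : Type*} [Fintype α] [DecidableEq α] {L : List (List α)}
    (h : L.flatten.Nodup) : ((L.map fun l : List α => l.formPerm⁻¹).prod).cycleType =
      ((L.map List.length : List ℕ) : Multiset ℕ).filter (2 ≤ ·) := by
  induction L with
  | nil => simp
  | cons l L ih =>
    rw [List.flatten_cons, List.nodup_append] at h
    have hd : l.formPerm⁻¹.Disjoint (L.map fun l => l.formPerm⁻¹).prod := by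
      refine Equiv.Perm.disjoint_prod_right _ fun g hg => ?_
      obtain ⟨l', hl', rfl⟩ := List.mem_map.mp hg
      refine Equiv.Perm.Disjoint.inv_left (Equiv.Perm.Disjoint.inv_right ?_)
      intro x
      by_contra! hx
      exact h.2.2 x (List.mem_of_formPerm_apply_ne hx.1) x
        (List.mem_flatten_of_mem hl' (List.mem_of_formPerm_apply_ne hx.2)) rfl
    rw [List.map_cons, List.prod_cons, hd.cycleType_mul, ih h.2.1, Equiv.Perm.cycleType_inv,
      cycleType_formPerm_of_nodup h.1, List.map_cons, ← Multiset.cons_coe, Multiset.filter_cons]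

theorem modType_prodCyc {n : ℕ} {L : List (List ℕ)} (h : Covers n L) :
    modType n (theta (prodCyc L)) =
      (((L.map List.length : List ℕ) : Multiset ℕ).filter (2 ≤ ·)).map (· - 1) := by
  -- `modType` is defined through the restricted permutation, so the cycles are lifted to lists of
  -- points of the subtype.
  obtain ⟨L', rfl⟩ : ∃ L' : List (List {k // k < n}), L'.map (List.map Subtype.val) = L := by
    have hL : ∀ l ∈ L, ∃ l' : List {k // k < n}, l'.map Subtype.val = l := by
      intro l hl
      have : ∀ x ∈ l, x < n := fun x hx => h.mem_iff.mp (List.mem_flatten_of_mem hl hx)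
      lift l to List {k // k < n} using this
      exact ⟨l, rfl⟩
    choose! f hf using hL
    refine ⟨L.map f, ?_⟩
    rw [List.map_map]
    conv_rhs => rw [← List.map_id L]
    exact List.map_congr_left hf
  have hθ : ∀ k, theta (prodCyc (L'.map (List.map Subtype.val))) k < n ↔ k < n :=
    fun k => theta_lt_iff h.prodCyc_mem
  rw [modType, dif_pos hθ]
  have e : (theta (prodCyc (L'.map (List.map Subtype.val)))).subtypePerm (p := fun k => k < n) hθ =
      (L'.map fun l => l.formPerm⁻¹).prod := by
    ext x
    exact theta_prodCyc_val_apply L' h.nodup x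
  have hnd : L'.flatten.Nodup := by
    have := h.nodup
    rw [← List.map_flatten] at this
    exact this.of_map
  rw [e]
  congr 1
  convert @cycleType_prod_formPerm _ _ _ L' hnd using 3
  simp

theorem sum_filter_two_le (s : Multiset ℕ) :
    ((s.filter (2 ≤ ·)).map (· - 1)).sum = (s.map (· - 1)).sum := by
  induction s using Multiset.induction_on with
  | empty => simp
  | cons a s ih =>
    rw [Multiset.filter_cons, Multiset.map_add, Multiset.sum_add, ih, Multiset.map_cons,
      Multiset.sum_cons]
    split_ifs with h
    · simp
    · simp; omega

/-- A cycle of length `k` contributes `k - 1`. This translates degree bounds into bounds on the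
number of cycles. -/
theorem degree_prodCyc {n : ℕ} {L : List (List ℕ)} (h : Covers n L) :
    degree n (prodCyc L) + L.length = n := by
  rw [degree, modType_prodCyc h, sum_filter_two_le]
  have h1 := h.perm.length_eq
  rw [List.length_range] at h1
  have h2 := h.ne_nil
  conv_rhs => rw [← h1]
  clear h1 h
  induction L with
  | nil => simp
  | cons l L ih =>
    have h3 := ih fun l hl => h2 l (by simp [hl])
    have h4 := List.length_pos_iff.mpr (h2 l (by simp))
    simp only [List.map_cons, Multiset.map_coe, Multiset.sum_coe, List.sum_cons, List.length_cons,
      List.flatten_cons, List.length_append] at h3 ⊢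
    omega

theorem PM.theta_eq {g h : Cover} (e : PM g h) : theta g = theta h := by
  rcases e with rfl | rfl
  · rfl
  · rw [map_mul, theta_z, one_mul]

theorem PM.degree_eq {n : ℕ} {g h : Cover} (e : PM g h) : degree n g = degree n h := by
  rw [degree, degree, e.theta_eq]

/-- Elements of the finite cover whose permutations have the same modified type are conjugate, up to
a sign. -/
theorem exists_pm_conj {n : ℕ} {g h : Cover} (hg : g ∈ coverN n) (hh : h ∈ coverN n)
    (e : modType n (theta g) = modType n (theta h)) : ∃ s ∈ coverN n, PM h (s * g * s⁻¹) := by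
  classical
  let _ : Fintype {k // k < n} := Fintype.ofFinite _
  have hg' : ∀ k, theta g k < n ↔ k < n := fun k => theta_lt_iff hg
  have hh' : ∀ k, theta h k < n ↔ k < n := fun k => theta_lt_iff hh
  rw [modType, modType, dif_pos hg', dif_pos hh'] at e
  have e' := congrArg (Multiset.map (· + 1)) e
  have key (s : Multiset ℕ) (hs : ∀ a ∈ s, 2 ≤ a) : (s.map (· - 1)).map (· + 1) = s := by
    rw [Multiset.map_map]
    conv_rhs => rw [← Multiset.map_id s]
    refine Multiset.map_congr rfl fun a ha => ?_
    have := hs a ha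
    simp only [Function.comp_apply, id]
    omega
  rw [key _ fun a => Equiv.Perm.two_le_of_mem_cycleType,
    key _ fun a => Equiv.Perm.two_le_of_mem_cycleType, ← Equiv.Perm.isConj_iff_cycleType_eq,
    isConj_iff] at e'
  obtain ⟨p, hp⟩ := e'
  obtain ⟨s, hs, hsp⟩ := exists_theta_eq n p
  refine ⟨s, hs, eq_or_eq_z_mul hh (mul_mem (mul_mem hs hg) (inv_mem hs)) ?_⟩
  ext x
  rcases Nat.lt_or_ge x n with hx | hx
  · have h1 : theta s⁻¹ x = (p⁻¹ ⟨x, hx⟩ : {k // k < n}) := by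
      rw [map_inv, Equiv.Perm.inv_eq_iff_eq, hsp, ← Equiv.Perm.mul_apply, mul_inv_cancel]
      rfl
    have h2 := congrArg Subtype.val (DFunLike.congr_fun hp ⟨x, hx⟩)
    rw [map_mul, map_mul, Equiv.Perm.mul_apply, Equiv.Perm.mul_apply, h1]
    rw [Equiv.Perm.mul_apply, Equiv.Perm.mul_apply] at h2
    rw [← hsp] at h2
    exact h2.symm
  · rw [theta_apply_of_le hh hx,
      theta_apply_of_le (mul_mem (mul_mem hs hg) (inv_mem hs)) hx]

section Distinguished

/-! ### The distinguished elements -/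

/-- The consecutive cycles whose lifts are the factors of `blocks`. -/
def blockList : ℕ → List ℕ → List (List ℕ)
  | _, [] => []
  | s, a :: l => (s :: (List.range' (s + 1) a).reverse) :: blockList (s + a + 1) l

/-- The outer factors `x n s` collapse to a square, which is the `z`; the other sign has exponent
`a`, which is even. For `a = 0` it is the convention `[s] = z`. -/
theorem cycle_range' {n s a : ℕ} (ha : Even a) (h : s + a < n) :
    cycle n (List.range' s (a + 1)) = z * cyc (s :: (List.range' (s + 1) a).reverse) := by
  cases a with
  | zero => simp [cycle, cyc]
  | succ a =>
    have hx {j : ℕ} (hj : j < n) : x n j = tau n j := by rw [tau, if_pos hj]; rfl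
    have h1 : cycle n (List.range' s (a + 1 + 1)) = x n s *
        ((List.range' (s + 1) (a + 1)).reverse.map (x n)).prod * x n s := rfl
    have h2 : ((List.range' (s + 1) (a + 1)).reverse.map (x n)) =
        ((List.range' (s + 1) (a + 1)).reverse.map (tau n)) := by
      refine List.map_congr_left fun k hk => hx ?_
      simp only [List.mem_reverse, List.mem_range'_1] at hk
      omega
    have h3 : (n :: s :: (List.range' (s + 1) (a + 1)).reverse).Nodup := by
      rw [List.nodup_cons, List.nodup_cons, List.nodup_reverse]
      refine ⟨?_, ?_, List.nodup_range' _ one_pos⟩ <;>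
        simp only [List.mem_cons, List.mem_reverse, List.mem_range'_1] <;> omega
    rw [h1, h2, hx (by omega), ← List.prod_cons, ← List.map_cons, ← star, star_cons_eq h3,
      List.length_reverse, List.length_range', z_pow_of_even ha, one_mul, mul_assoc,
      tau_mul_self (by omega), ← z_comm]
    rfl

theorem blocks_eq {n s : ℕ} {l : List ℕ} (hl : ∀ a ∈ l, Even a) (h : s + l.sum + l.length ≤ n) :
    blocks n s l = z ^ l.length * prodCyc (blockList s l) := by
  induction l generalizing s with
  | nil => simp [blocks, blockList]
  | cons a l ih =>
    rw [List.sum_cons, List.length_cons] at h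
    rw [blocks, blockList, prodCyc_cons, cycle_range' (hl a (by simp)) (by omega),
      ih (fun b hb => hl b (by simp [hb])) (by omega), mul_assoc, z_pow_left, List.length_cons, pow_succ',
      mul_assoc]

theorem flatten_blockList (s : ℕ) (l : List ℕ) :
    (blockList s l).flatten.Perm (List.range' s (l.sum + l.length)) := by
  induction l generalizing s with
  | nil => simp [blockList]
  | cons a l ih =>
    have e : List.range' s ((a :: l).sum + (a :: l).length) =
        List.range' s (a + 1) ++ List.range' (s + a + 1) (l.sum + l.length) := by
      rw [add_assoc s, List.range'_append_1, List.sum_cons, List.length_cons]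
      congr 1
      omega
    rw [blockList, List.flatten_cons, e, List.range'_succ]
    exact List.Perm.append ((List.reverse_perm _).cons s) (ih _)

theorem map_length_blockList (s : ℕ) (l : List ℕ) :
    (blockList s l).map List.length = l.map (· + 1) := by
  induction l generalizing s with
  | nil => rfl
  | cons a l ih => simp [blockList, ih]

/-- The cycles of `tElt n lam`, including the fixed points. -/
def tList (n : ℕ) {m : ℕ} (lam : Nat.Partition m) : List (List ℕ) :=
  blockList 0 (lam.parts.sort (· ≥ ·)) ++
    (List.range' (m + lam.parts.card) (n - (m + lam.parts.card))).map fun k => [k]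

variable {n m : ℕ} {lam : Nat.Partition m}

theorem sum_sort_parts (lam : Nat.Partition m) : (lam.parts.sort (· ≥ ·)).sum = m := by
  rw [← Multiset.sum_coe, Multiset.sort_eq, lam.parts_sum]

theorem flatten_map_singleton (l : List ℕ) : (l.map fun k => [k]).flatten = l := by
  induction l with
  | nil => rfl
  | cons a l ih => rw [List.map_cons, List.flatten_cons, ih, List.singleton_append]

theorem covers_tList (h : m + lam.parts.card ≤ n) : Covers n (tList n lam) := by
  refine ⟨?_, ?_⟩
  · have := flatten_blockList 0 (lam.parts.sort (· ≥ ·))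
    rw [sum_sort_parts, Multiset.length_sort] at this
    rw [tList, List.flatten_append, flatten_map_singleton]
    refine (this.append_right _).trans ?_
    have e := List.range'_append_1 (s := 0) (m := m + lam.parts.card) (n := n - (m + lam.parts.card))
    rw [zero_add] at e
    rw [e, List.range_eq_range', Nat.add_sub_cancel' h]
  · intro l hl
    rw [tList, List.mem_append] at hl
    rcases hl with hl | hl
    · have : l.length ∈ (blockList 0 (lam.parts.sort (· ≥ ·))).map List.length :=
        List.mem_map_of_mem hl
      rw [map_length_blockList] at this
      obtain ⟨a, -, ha⟩ := List.mem_map.mp this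
      rw [← List.length_pos_iff]
      omega
    · obtain ⟨k, -, rfl⟩ := List.mem_map.mp hl
      simp

theorem map_length_tList : (tList n lam).map List.length = (lam.parts.sort (· ≥ ·)).map (· + 1) ++
    List.replicate (n - (m + lam.parts.card)) 1 := by
  rw [tList, List.map_append, map_length_blockList, List.map_map]
  congr 1
  rw [List.eq_replicate_iff]
  refine ⟨by simp, fun b hb => ?_⟩
  obtain ⟨k, -, rfl⟩ := List.mem_map.mp hb
  rfl

theorem length_tList (h : m + lam.parts.card ≤ n) : m + (tList n lam).length = n := by
  rw [← List.length_map (f := List.length), map_length_tList, List.length_append, List.length_map,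
    Multiset.length_sort, List.length_replicate]
  omega

theorem prodCyc_map_singleton (l : List ℕ) : prodCyc (l.map fun k => [k]) = 1 := by
  induction l with
  | nil => rfl
  | cons a l ih => rw [List.map_cons, prodCyc_cons, ih]; rfl

theorem tElt_eq (hlam : ∀ a ∈ lam.parts, Even a) (h : m + lam.parts.card ≤ n) :
    tElt n lam = z ^ lam.parts.card * prodCyc (tList n lam) := by
  rw [tElt, blocks_eq, Multiset.length_sort, tList, prodCyc_append, prodCyc_map_singleton, mul_one]
  · intro a ha
    exact hlam a ((Multiset.mem_sort _).mp ha)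
  · rw [sum_sort_parts, Multiset.length_sort, zero_add]
    exact h

theorem tElt_pm (hlam : ∀ a ∈ lam.parts, Even a) (h : m + lam.parts.card ≤ n) :
    PM (tElt n lam) (prodCyc (tList n lam)) := by
  rw [tElt_eq hlam h]
  exact pm_z_pow_mul _ _

theorem odd_length_of_mem_tList (hlam : ∀ a ∈ lam.parts, Even a) :
    ∀ l ∈ tList n lam, Odd l.length := by
  intro l hl
  have : l.length ∈ (tList n lam).map List.length := List.mem_map_of_mem hl
  rw [map_length_tList, List.mem_append] at this
  rcases this with h | h
  · obtain ⟨a, ha, e⟩ := List.mem_map.mp h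
    rw [← e]
    exact (hlam a ((Multiset.mem_sort _).mp ha)).add_one
  · rw [List.eq_of_mem_replicate h]
    exact odd_one

theorem listWeight_eq (L : List (List ℕ)) : listWeight L = ((L.map List.length).map weight).prod := by
  rw [listWeight, List.map_map]
  rfl

theorem listWeight_tList (hlam : ∀ a ∈ lam.parts, Even a) :
    listWeight (tList n lam) = (lam.parts.map fun a => catalan (a / 2)).prod := by
  have h1 : weight 1 = 1 := (weight_odd 0).trans catalan_zero
  rw [listWeight_eq, map_length_tList, List.map_append, List.prod_append, List.map_replicate, h1,
    List.prod_replicate, one_pow, mul_one, List.map_map, ← Multiset.prod_coe, ← Multiset.map_coe,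
    Multiset.sort_eq]
  congr 1
  refine Multiset.map_congr rfl fun a ha => ?_
  obtain ⟨k, rfl⟩ := hlam a ha
  rw [Function.comp_apply, ← two_mul, weight_odd, Nat.mul_div_cancel_left _ two_pos]

theorem modType_tElt (hlam : ∀ a ∈ lam.parts, Even a) (h : m + lam.parts.card ≤ n) :
    modType n (theta (tElt n lam)) = lam.parts := by
  have h1 (k : ℕ) : ((List.replicate k 1 : List ℕ) : Multiset ℕ).filter (2 ≤ ·) = 0 := by
    rw [Multiset.filter_eq_nil]
    intro a ha
    rw [List.eq_of_mem_replicate (Multiset.mem_coe.mp ha)]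
    omega
  rw [(tElt_pm hlam h).theta_eq, modType_prodCyc (covers_tList h), map_length_tList,
    ← Multiset.coe_add, Multiset.filter_add, h1, add_zero, ← Multiset.map_coe, Multiset.sort_eq, Multiset.filter_eq_self.mpr, Multiset.map_map]
  · simp
  · intro a ha
    obtain ⟨b, hb, rfl⟩ := Multiset.mem_map.mp ha
    have := lam.parts_pos hb
    omega

/-- The value of the coefficient of `tElt n lam` in the elementary symmetric function. -/
def topCoeff (lam : Nat.Partition m) : ℤ :=
  (-1) ^ lam.parts.card * (lam.parts.map fun a => (catalan (a / 2) : ℤ)).prod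

/-- Used twice: to keep `z * g` out of the class of `g`, and to see that degree `2 r` is attained
over `ℤ`. -/
theorem topCoeff_ne_zero (lam : Nat.Partition m) : topCoeff lam ≠ 0 := by
  refine mul_ne_zero (pow_ne_zero _ (by norm_num)) ?_
  rw [Ne, Multiset.prod_eq_zero_iff, Multiset.mem_map]
  rintro ⟨a, -, ha⟩
  exact (catalan_pos _).ne' (by exact_mod_cast ha)

variable {R : Type*} [CommRing R]

theorem coeff_z_pow_mul (k : ℕ) (g : Cover) (a : SpinAlg R) :
    coeff R (z ^ k * g) a = (-1) ^ k * coeff R g a := by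
  induction k with
  | zero => simp
  | succ k ih => rw [pow_succ', mul_assoc, coeff_z_mul, ih, pow_succ]; ring

theorem mem_EP {lam : Nat.Partition m} : lam ∈ EP m ↔ ∀ a ∈ lam.parts, Even a := by
  simp [EP]

/-- The coefficients of the elements of `classD n lam` in the elementary symmetric function. -/
theorem coeff_elemSymm_conj {r n : ℕ} {lam : Nat.Partition (2 * r)} (hlam : lam ∈ EP (2 * r))
    (h : 2 * r + lam.parts.card ≤ n) {s : Cover} (hs : s ∈ coverN n) :
    coeff R (s * tElt n lam * s⁻¹) (elemSymm R r n) = (topCoeff lam : R) := by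
  rw [mem_EP] at hlam
  have hc := covers_tList h
  have hodd := odd_length_of_mem_tList (n := n) hlam
  -- All cycles are odd, so conjugation only relabels their points and `coeff_elemSymm` applies to
  -- the relabelled list, which has the same lengths.
  rw [tElt_eq hlam h, z_pow_left, mul_prodCyc s hc.nodup hodd, mul_assoc, mul_inv_cancel_right,
    coeff_z_pow_mul, coeff_elemSymm, expected, List.length_map, if_pos (length_tList h)]
  · have e : listWeight ((tList n lam).map (List.map (theta s))) = listWeight (tList n lam) := by
      simp [listWeight_eq, Function.comp_def]
    rw [e, listWeight_tList hlam, topCoeff]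
    push_cast [Multiset.map_map]
    simp
  · refine ⟨?_, ?_⟩
    · rw [← List.map_flatten]
      refine (hc.perm.map _).trans ?_
      rw [List.perm_ext_iff_of_nodup (List.nodup_range.map (theta s).injective) List.nodup_range]
      intro a
      rw [List.mem_map, List.mem_range]
      constructor
      · rintro ⟨b, hb, rfl⟩
        exact (theta_lt_iff hs).mpr (List.mem_range.mp hb)
      · intro ha
        refine ⟨(theta s).symm a, ?_, by simp⟩
        rw [List.mem_range, ← theta_lt_iff hs]
        simpa using ha
    · intro l hl
      obtain ⟨l', hl', rfl⟩ := List.mem_map.mp hl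
      simpa using hc.ne_nil l' hl'
  · rw [List.length_map, length_tList h]

theorem coeff_tElt {r n : ℕ} {lam : Nat.Partition (2 * r)} (hlam : lam ∈ EP (2 * r))
    (h : 2 * r + lam.parts.card ≤ n) :
    coeff R (tElt n lam) (elemSymm R r n) = (topCoeff lam : R) := by
  simpa using coeff_elemSymm_conj (R := R) hlam h (one_mem _)

theorem A_eq {r : ℕ} {lam : Nat.Partition (2 * r)} (hlam : lam ∈ EP (2 * r)) :
    A lam = topCoeff lam := by
  rw [A, Nat.mul_div_cancel_left _ two_pos, coeff_tElt hlam le_rfl, Int.cast_id]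

end Distinguished

section TopDegree

/-! ### The top degree part -/

/-- Equality up to sign, as a setoid. -/
def pmSetoid : Setoid Cover where
  r := PM
  iseqv := ⟨fun _ => Or.inl rfl, PM.symm, PM.trans⟩

/-- A chosen representative of an element up to sign. -/
noncomputable def rep (g : Cover) : Cover := (Quotient.mk pmSetoid g).out

theorem rep_pm (g : Cover) : PM (rep g) g := Quotient.exact (s := pmSetoid) (Quotient.out_eq _)

theorem rep_eq {g h : Cover} (e : PM g h) : rep g = rep h :=
  congrArg Quotient.out (Quotient.sound (s := pmSetoid) e)

variable {R : Type*} [CommRing R]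

theorem spinSpan_le_span_rep (n : ℕ) :
    spinSpan R n ≤ Submodule.span R (im R '' (rep '' coverN n)) := by
  refine Submodule.span_le.mpr ?_
  rintro _ ⟨g, hg, rfl⟩
  have h : im R (rep g) ∈ Submodule.span R (im R '' (rep '' coverN n)) :=
    Submodule.subset_span ⟨_, ⟨g, hg, rfl⟩, rfl⟩
  rcases (rep_pm g).symm with e | e
  · rw [← e] at h
    exact h
  · rw [e, im_z_mul]
    exact neg_mem h

/-- In an expansion over one representative for each pair `g`, `z * g`, the functionals `coeff` read
off the scalars, so representatives of degree at least `m` do not occur. -/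
theorem mem_lower_of_coeff {n m : ℕ} {a : SpinAlg R} (ha : a ∈ spinSpan R n)
    (h : ∀ g ∈ coverN n, m ≤ degree n g → coeff R g a = 0) : a ∈ lower R n m := by
  obtain ⟨f, hf, rfl⟩ := (Finsupp.mem_span_image_iff_linearCombination R).mp
    (spinSpan_le_span_rep n ha)
  rw [Finsupp.mem_supported] at hf
  have hrep : ∀ g ∈ f.support, g ∈ coverN n ∧ rep g = g := by
    intro g hg
    obtain ⟨k, hk, rfl⟩ := hf hg
    exact ⟨(rep_pm k).mem_coverN hk, rep_eq (rep_pm k)⟩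
  rw [Finsupp.linearCombination_apply, Finsupp.sum] at h ⊢
  refine sum_mem fun g hg => ?_
  have hc : coeff R g (∑ k ∈ f.support, f k • im R k) = f g := by
    rw [map_sum, Finset.sum_eq_single g, coeff_smul, coeff_im_self, mul_one]
    · intro k hk hkg
      rw [coeff_smul, coeff_im_of_not_pm, mul_zero]
      intro e
      have := rep_eq e
      rw [(hrep g hg).2, (hrep k hk).2] at this
      exact hkg this.symm
    · intro h'
      exact absurd hg h'
  refine Submodule.smul_mem _ _ (Submodule.subset_span ⟨g, (hrep g hg).1, ?_, rfl⟩)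
  by_contra hd
  exact (Finsupp.mem_support_iff.mp hg) (hc ▸ h g (hrep g hg).1 (not_lt.mp hd))

theorem coeff_eq_zero_of_mem_lower {n m : ℕ} {a : SpinAlg R} (ha : a ∈ lower R n m) {g : Cover}
    (hg : m ≤ degree n g) : coeff R g a = 0 := by
  refine coeff_eq_zero_of_span (s := {g | g ∈ coverN n ∧ degree n g < m}) ?_ ?_
  · rintro h ⟨-, hh⟩ e
    rw [e.degree_eq] at hg
    omega
  · refine Submodule.span_mono ?_ ha
    rintro _ ⟨g, hg, hd, rfl⟩
    exact ⟨g, ⟨hg, hd⟩, rfl⟩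

/-! ### Classes and class sums -/

section Classes

variable {n m : ℕ} {lam : Nat.Partition m}

theorem modType_conj {s g : Cover} (hs : s ∈ coverN n) (hg : g ∈ coverN n) :
    modType n (theta (s * g * s⁻¹)) = modType n (theta g) := by
  have h1 : ∀ k, theta g k < n ↔ k < n := fun k => theta_lt_iff hg
  have h2 : ∀ k, theta s k < n ↔ k < n := fun k => theta_lt_iff hs
  have h3 : ∀ k, theta (s * g * s⁻¹) k < n ↔ k < n :=
    fun k => theta_lt_iff (mul_mem (mul_mem hs hg) (inv_mem hs))
  rw [modType, modType, dif_pos h1, dif_pos h3]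
  congr 1
  have e : (theta (s * g * s⁻¹)).subtypePerm (p := fun k => k < n) h3 =
      (theta s).subtypePerm (p := fun k => k < n) h2 * (theta g).subtypePerm (p := fun k => k < n) h1 *
        ((theta s).subtypePerm (p := fun k => k < n) h2)⁻¹ := by
    rw [eq_mul_inv_iff_mul_eq]
    ext k
    change theta (s * g * s⁻¹) (theta s k) = theta s (theta g k)
    rw [← Equiv.Perm.mul_apply, ← map_mul, inv_mul_cancel_right, map_mul, Equiv.Perm.mul_apply]
  let _ : Fintype {k // k < n} := Fintype.ofFinite _
  rw [e]
  convert Equiv.Perm.cycleType_conj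

theorem tElt_mem_coverN (hlam : ∀ a ∈ lam.parts, Even a) (h : m + lam.parts.card ≤ n) :
    tElt n lam ∈ coverN n :=
  (tElt_pm hlam h).mem_coverN (covers_tList h).prodCyc_mem

theorem classD_subset (hlam : lam ∈ EP m) {g : Cover} (hg : g ∈ classD n lam) : g ∈ coverN n := by
  obtain ⟨h, s, hs, rfl⟩ := hg
  exact mul_mem (mul_mem hs (tElt_mem_coverN (mem_EP.mp hlam) h)) (inv_mem hs)

theorem modType_of_mem_classD (hlam : lam ∈ EP m) {g : Cover} (hg : g ∈ classD n lam) :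
    modType n (theta g) = lam.parts := by
  obtain ⟨h, s, hs, rfl⟩ := hg
  rw [modType_conj hs (tElt_mem_coverN (mem_EP.mp hlam) h), modType_tElt (mem_EP.mp hlam) h]

theorem degree_of_mem_classD (hlam : lam ∈ EP m) {g : Cover} (hg : g ∈ classD n lam) :
    degree n g = m := by
  rw [degree, modType_of_mem_classD hlam hg, lam.parts_sum]

theorem finite_classD (hlam : lam ∈ EP m) : (classD n lam).Finite :=
  (finite_coverN n).subset fun _ hg => classD_subset hlam hg

variable (R) in
theorem classSum_eq (hlam : lam ∈ EP m) :
    classSum R n lam = ∑ g ∈ (finite_classD (n := n) hlam).toFinset, im R g :=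
  finsum_mem_eq_finite_toFinset_sum _ _

theorem classSum_mem_span (hlam : lam ∈ EP m) :
    classSum R n lam ∈ Submodule.span R (im R '' classD n lam) := by
  rw [classSum_eq R hlam]
  refine sum_mem fun g hg => Submodule.subset_span ⟨g, ?_, rfl⟩
  simpa using hg

theorem classSum_mem_homogeneous (hlam : lam ∈ EP m) : classSum R n lam ∈ homogeneous R n m := by
  refine Submodule.span_mono ?_ (classSum_mem_span hlam)
  rintro _ ⟨g, hg, rfl⟩
  exact ⟨g, classD_subset hlam hg, degree_of_mem_classD hlam hg, rfl⟩

theorem classSum_mem_spinSpan (hlam : lam ∈ EP m) : classSum R n lam ∈ spinSpan R n :=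
  Submodule.span_mono (Set.image_mono fun _ hg => classD_subset hlam hg) (classSum_mem_span hlam)

theorem coeff_classSum_of_not_pm (hlam : lam ∈ EP m) {g : Cover}
    (h : ∀ k ∈ classD n lam, ¬PM g k) : coeff R g (classSum R n lam) = 0 :=
  coeff_eq_zero_of_span h (classSum_mem_span hlam)

end Classes

/-! ### Comparison with the class sums -/

theorem coeff_elemSymm_of_mem_classD {r n : ℕ} {lam : Nat.Partition (2 * r)} (hlam : lam ∈ EP (2 * r))
    {g : Cover} (hg : g ∈ classD n lam) : coeff R g (elemSymm R r n) = (topCoeff lam : R) := by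
  obtain ⟨h, s, hs, rfl⟩ := hg
  exact coeff_elemSymm_conj hlam h hs

/-- The integral coefficient in `elemSymm` is constant on the class and nonzero, but changes sign
under `z`. Hence class sums do not cancel, over any `R`. -/
theorem z_mul_notMem_classD {r n : ℕ} {lam : Nat.Partition (2 * r)} (hlam : lam ∈ EP (2 * r))
    {g : Cover} (hg : g ∈ classD n lam) : z * g ∉ classD n lam := by
  intro hz
  have h1 := coeff_elemSymm_of_mem_classD (R := ℤ) hlam hg
  have h2 := coeff_elemSymm_of_mem_classD (R := ℤ) hlam hz
  rw [coeff_z_mul, h1] at h2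
  have := topCoeff_ne_zero lam
  simp only [Int.cast_id] at h2
  omega

theorem coeff_classSum_self {r n : ℕ} {lam : Nat.Partition (2 * r)} (hlam : lam ∈ EP (2 * r))
    {g : Cover} (hg : g ∈ classD n lam) : coeff R g (classSum R n lam) = 1 := by
  rw [classSum_eq R hlam, map_sum, Finset.sum_eq_single g, coeff_im_self]
  · intro k hk hkg
    refine coeff_im_of_not_pm R fun e => ?_
    rw [Set.Finite.mem_toFinset] at hk
    rcases e with e | e
    · exact hkg e.symm
    · exact z_mul_notMem_classD hlam hk (e ▸ hg)
  · intro h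
    exact absurd (by simpa using hg) h

/-- The partition is the modified type: odd cycle lengths give even parts, and its number of parts
is at most the number of cycles, so `t_λ` fits into `n` points. -/
theorem exists_mem_classD {r n : ℕ} {L : List (List ℕ)} (hL : Covers n L) (hr : 2 * r + L.length = n)
    (hodd : ∀ l ∈ L, Odd l.length) : ∃ lam ∈ EP (2 * r), ∃ h ∈ classD n lam, PM (prodCyc L) h := by
  have hm := modType_prodCyc hL
  have hd := degree_prodCyc hL
  have hsum : (modType n (theta (prodCyc L))).sum = 2 * r := by
    rw [degree] at hd
    omega
  have hmem : ∀ {a}, a ∈ modType n (theta (prodCyc L)) → 0 < a ∧ Even a := by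
    intro a ha
    rw [hm] at ha
    obtain ⟨b, hb, rfl⟩ := Multiset.mem_map.mp ha
    rw [Multiset.mem_filter] at hb
    obtain ⟨l, hl, rfl⟩ := List.mem_map.mp (Multiset.mem_coe.mp hb.1)
    exact ⟨by omega, Nat.Odd.sub_odd (hodd l hl) odd_one⟩
  let lam : Nat.Partition (2 * r) := ⟨modType n (theta (prodCyc L)), fun ha => (hmem ha).1, hsum⟩
  have hlam : lam ∈ EP (2 * r) := mem_EP.mpr fun a ha => (hmem ha).2
  have hcard : 2 * r + lam.parts.card ≤ n := by
    have : lam.parts.card ≤ L.length := by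
      change (modType n (theta (prodCyc L))).card ≤ L.length
      rw [hm, Multiset.card_map]
      refine (Multiset.card_le_card (Multiset.filter_le _ _)).trans ?_
      rw [Multiset.coe_card, List.length_map]
    omega
  have ht := tElt_mem_coverN (mem_EP.mp hlam) hcard
  obtain ⟨s, hs, e⟩ := exists_pm_conj ht hL.prodCyc_mem (modType_tElt (mem_EP.mp hlam) hcard)
  exact ⟨lam, hlam, _, ⟨hcard, s, hs, rfl⟩, e⟩

theorem elemSymm_sub_mem_lower (r n : ℕ) :
    elemSymm R r n - ∑ lam ∈ EP (2 * r), A lam • classSum R n lam ∈ lower R n (2 * r) := by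
  refine mem_lower_of_coeff (sub_mem (elemSymm_mem_spinSpan R r n)
    (sum_mem fun lam hlam => zsmul_mem (classSum_mem_spinSpan hlam) _)) fun g hg hd => ?_
  rw [map_sub, map_sum]
  simp only [map_zsmul]
  by_cases hex : ∃ lam ∈ EP (2 * r), ∃ h ∈ classD n lam, PM g h
  · obtain ⟨lam, hlam, h, hh, e⟩ := hex
    have key : coeff R h (elemSymm R r n) -
        ∑ lam ∈ EP (2 * r), A lam • coeff R h (classSum R n lam) = 0 := by
      rw [Finset.sum_eq_single lam, coeff_classSum_self hlam hh, coeff_elemSymm_of_mem_classD hlam hh,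
        A_eq hlam, zsmul_one, sub_self]
      · intro mu hmu hne
        rw [coeff_classSum_of_not_pm hmu, smul_zero]
        intro k hk e'
        refine hne (Nat.Partition.ext ?_)
        rw [← modType_of_mem_classD hmu hk, ← e'.theta_eq, modType_of_mem_classD hlam hh]
      · intro h'
        exact absurd hlam h'
    -- Both sides change sign under `z`, so it suffices to compare them at the member `h` of the
    -- class.
    rcases e with rfl | rfl
    · exact key
    · simp only [coeff_z_mul, smul_neg, Finset.sum_neg_distrib]
      rw [← neg_sub', key, neg_zero]
  · rw [Finset.sum_eq_zero, sub_zero]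
    · obtain ⟨L, hL, e⟩ := exists_prodCyc hg
      refine coeff_eq_zero_of_pm e ?_
      have hdeg := degree_prodCyc hL
      rw [← e.degree_eq] at hdeg
      -- Outside all `±` classes, either the degree exceeds `2 * r` or some cycle has even length;
      -- the coefficient vanishes in both cases.
      rw [coeff_elemSymm R n r hL (by omega), expected]
      split_ifs with hr
      · by_cases hodd : ∀ l ∈ L, Odd l.length
        · obtain ⟨lam, hlam, h, hh, e'⟩ := exists_mem_classD hL hr hodd
          exact absurd ⟨lam, hlam, h, hh, e.trans e'⟩ hex
        · push Not at hodd
          obtain ⟨l, hl, hev⟩ := hodd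
          have : listWeight L = 0 := by
            refine List.prod_eq_zero_iff.mpr (List.mem_map.mpr ⟨l, hl, ?_⟩)
            exact weight_of_even (by simpa using hev)
          rw [this, Nat.cast_zero]
      · rfl
    · intro lam hlam
      rw [coeff_classSum_of_not_pm hlam, smul_zero]
      exact fun k hk e => hex ⟨lam, hlam, k, hk, e⟩

theorem indiscrete_mem_EP {m : ℕ} (hm : Even m) : Nat.Partition.indiscrete m ∈ EP m := by
  rw [mem_EP]
  rcases eq_or_ne m 0 with rfl | h
  · simp
  · simpa [Nat.Partition.indiscrete_parts h] using hm

theorem topCoeff_indiscrete {m : ℕ} (hm : m ≠ 0) :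
    topCoeff (Nat.Partition.indiscrete m) = -(catalan (m / 2) : ℤ) := by
  simp [topCoeff, Nat.Partition.indiscrete_parts hm]

end TopDegree

end SpinSym

/-! ### Assembly of the theorem -/

theorem mainTheorem3 (R : Type*) [CommRing R] :
    -- the coefficient of `t_λ` in `e_{r;n}` does not depend on `n`: `A_λ` is well defined
    (∀ r n : ℕ, ∀ lam ∈ SpinSym.EP (2 * r), 2 * r + lam.parts.card ≤ n →
      SpinSym.coeff R (SpinSym.tElt n lam) (SpinSym.elemSymm R r n) = (SpinSym.A lam : R)) ∧
    -- the degree `2 r` part of `e_{r;n}` is `∑ A_λ d_λ(n)`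
    (∀ r n : ℕ,
      (∑ lam ∈ SpinSym.EP (2 * r), SpinSym.A lam • SpinSym.classSum R n lam) ∈
          SpinSym.homogeneous R n (2 * r) ∧
        SpinSym.elemSymm R r n -
            ∑ lam ∈ SpinSym.EP (2 * r), SpinSym.A lam • SpinSym.classSum R n lam ∈
          SpinSym.lower R n (2 * r)) ∧
    -- over `ℤ` and for large `n`, the part of degree `2 r` is the top degree part
    (∀ r n : ℕ, 2 * r < n → SpinSym.elemSymm ℤ r n ∉ SpinSym.lower ℤ n (2 * r)) ∧
    -- the values of the coefficients (`catalan m` is `binom(2m, m) / (m + 1) = C_{m+1}`)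
    (∀ r : ℕ, 1 ≤ r → SpinSym.A (Nat.Partition.indiscrete (2 * r)) = -(catalan r : ℤ)) ∧
    (∀ r : ℕ, ∀ lam ∈ SpinSym.EP (2 * r),
      SpinSym.A lam = (lam.parts.map fun a => SpinSym.A (Nat.Partition.indiscrete a)).prod ∧
      SpinSym.A lam =
        (-1) ^ lam.parts.card * (lam.parts.map fun a => (catalan (a / 2) : ℤ)).prod) := by
  refine ⟨fun r n lam hlam h => ?_, fun r n => ⟨?_, ?_⟩, fun r n h hl => ?_, fun r hr => ?_,
    fun r lam hlam => ⟨?_, SpinSym.A_eq hlam⟩⟩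
  · rw [SpinSym.coeff_tElt hlam h, SpinSym.A_eq hlam]
  · exact sum_mem fun lam hlam => zsmul_mem (SpinSym.classSum_mem_homogeneous hlam) _
  · exact SpinSym.elemSymm_sub_mem_lower r n
  -- The witness is the one-part partition, which needs just `2 * r + 1` points. For `r = 0` it is
  -- the empty partition, and the coefficient is `1`.
  · have hlam := SpinSym.indiscrete_mem_EP (even_two_mul r)
    have hcard : 2 * r + (Nat.Partition.indiscrete (2 * r)).parts.card ≤ n := by
      rcases eq_or_ne (2 * r) 0 with h0 | h0
      · obtain rfl : r = 0 := by omega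
        simp
      · rw [Nat.Partition.indiscrete_parts h0, Multiset.card_singleton]
        exact h
    refine SpinSym.topCoeff_ne_zero (Nat.Partition.indiscrete (2 * r)) ?_
    rw [← Int.cast_id (n := SpinSym.topCoeff _), ← SpinSym.coeff_tElt hlam hcard]
    refine SpinSym.coeff_eq_zero_of_mem_lower hl ?_
    rw [SpinSym.degree, SpinSym.modType_tElt (SpinSym.mem_EP.mp hlam) hcard,
      Nat.Partition.parts_sum]
  · rw [SpinSym.A_eq (SpinSym.indiscrete_mem_EP (even_two_mul r)),
      SpinSym.topCoeff_indiscrete (by omega), Nat.mul_div_cancel_left _ two_pos]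
  · have h : ∀ a ∈ lam.parts,
        SpinSym.A (Nat.Partition.indiscrete a) = -1 * (catalan (a / 2) : ℤ) := by
      intro a ha
      have h0 := (lam.parts_pos ha).ne'
      obtain ⟨k, rfl⟩ := (even_iff_exists_two_mul).mp (SpinSym.mem_EP.mp hlam a ha)
      rw [SpinSym.A_eq (SpinSym.indiscrete_mem_EP (even_two_mul k)), SpinSym.topCoeff_indiscrete h0,
        neg_one_mul]
    rw [Multiset.map_congr rfl h, Multiset.prod_map_mul, Multiset.map_const', Multiset.prod_replicate,
      SpinSym.A_eq hlam, SpinSym.topCoeff]
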